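/- Let $n,k,r,\delta$ be integers with $1\le r\le k$ and $\delta\ge 2$, and let $\mathbb F_q$ be a finite field with $$q>(r\delta)^{r4^r}\binom{n+(r\delta)^{(r-1)4^r}}{k-1}.$$ **Definitions.** A $k$-dimensional subspace $C\subseteq\mathbb F_q^n$ with minimum Hamming distance $d$ is a linear LRC with parameters $(n,k,d)$ and all-symbol $(r,\delta)$-locality if each $j\in\{1,\dots,n\}$ lies in some $S\subseteq\{1,\dots,n\}$ with $|S|\le r+\delta-1$ such that the restriction of $C$ to the coordinates in $S$ has minimum distance at least $\delta$. Put $d_{\rm opt}(n,k,r,\delta)=n-k-(\lceil k/r\rceil-1)(\delta-1)+1$; $C$ is *optimal* if $d=d_{\rm opt}(n,k,r,\delta)$ and *almost optimal* if $d\ge d_{\rm opt}(n,k,r,\delta)-\delta+1$. **Construction.** Let $s_1,\dots,s_A$ be integers with $\delta\le s_i\le r+\delta-1$; put $t_i=s_i-\delta+1$. For each $i$ let $B_i$ be an $r\times(\delta-1)$ matrix over $\mathbb F_q$ all of whose square submatrices are invertible (the same matrix may be used for all $i$), and let $B_i'$ be its first $t_i$ rows. Let $U_0^{(i)}$ be the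 set of entries of $(I_r\,|\,B_i)$ and $U^{(i)}_{m+1}=\{x-yz/w: x,y,z,w\in U^{(i)}_m,\ w\ne0\}$. One chooses vectors $\mathbf g_{i,j}\in\mathbb F_q^k$ ($1\le i\le A$, $1\le j\le t_i$) one after another, block by block; once block $i$ is chosen, $S_i$ denotes the family of the $s_i$ columns of $G_i=(\mathbf g_{i,1}|\cdots|\mathbf g_{i,t_i})(I_{t_i}|B_i')$. The only requirements are: * $\mathbf g_{1,1},\dots,\mathbf g_{1,t_1}$ are linearly independent; * for $i\ge 2$, $\mathbf g_{i,1}$ is not in the linear hull of any at most $k-1$ columns of $S_1,\dots,S_{i-1}$, at most $t_m$ of them from $S_m$ for each $m$; * for $i,j\ge2$, no vector $\sum_{h\le j}u_h\mathbf g_{i,h}$ with all $u_h\in U_r^{(i)}$ and $u_j\ne0$ is in the linear hull of any at most $k-1$ vectors of which at most $t_m$ are columns of $S_m$ for each $m<i$, and the others, at most $j-1$ of them, are of the form $\sum_{h<j}u_h\mathbf g_{i,h}$ with all $u_h\in U_r^{(i)}$. The output is the $k\times\sum_i s_i$ matrix $\mathbf G=(G_1|\cdots|G_A)$. **Claims.**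 1. Suppose $\sum_i s_i=n$ and $n-A(\delta-1)\ge k$. Matrices $B_i$ as above exist. For every choice of them the construction never gets stuck (after any admissible choices there is an admissible next vector), so it has an outcome, and the matrix $\mathbf G$ of every outcome generates a linear LRC of length $n$ and dimension $k$ with all-symbol $(r,\delta)$-locality whose minimum distance is exactly $$n-(k-1)-z(\delta-1),$$ where, with the indices arranged so that $s_1\le\dots\le s_A$, $z$ is the unique integer with $\sum_{j=1}^{z}(s_j-\delta+1)\le k-1<\sum_{j=1}^{z+1}(s_j-\delta+1)$. 2. Suppose $n\not\equiv1,\dots,\delta-1\pmod{r+\delta-1}$ and $n-\lceil n/(r+\delta-1)\rceil(\delta-1)\ge k$. Put $A=\lceil n/(r+\delta-1)\rceil$, $b=A(r+\delta-1)-n$, $s_i=r+\delta-1$ for $i<A$ and $s_A=r+\delta-1-b$. These are admissible block sizes with sum $n$, and every code constructed with them is optimal if $(r+\delta-1)\mid n$, and almost optimal in any case. 3. Suppose $n=a(r+\delta-1)+b$ with $1\le b\le\delta-1$ and $k\le ar$ (which holds in particular if $n-\lceil n/(r+\delta-1)\rceil(\delta-1)\ge k$). Then matrices $B_i$ as above exist,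 and for every choice of them the construction with $A=a$ and $s_1=\dots=s_a=r+\delta-1$ never gets stuck and has an outcome. If $\mathbf G$ is the matrix of an outcome, then appending any $b$ copies of columns of $\mathbf G$ gives a generator matrix of a linear LRC of length $n$ and dimension $k$ with all-symbol $(r,\delta)$-locality and minimum distance $d\ge d_{\rm opt}(n-b,k,r,\delta)$; this code is almost optimal. -/

import Mathlib

open scoped BigOperators

/-- `d` is the minimum (Hamming) distance of the code `C ⊆ F ^ ι`. -/
def HasMinDist {ι F : Type*} [Fintype ι] [DecidableEq F] (C : Set (ι → F)) (d : ℕ) : Prop :=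
  IsLeast {e : ℕ | ∃ x ∈ C, ∃ y ∈ C, x ≠ y ∧ hammingDist x y = e} d

/-- The restriction of the code `C` to the code symbols in `S`. -/
def restrictCode {ι F : Type*} (C : Set (ι → F)) (S : Finset ι) : Set (S → F) :=
  (fun x (s : S) => x s) '' C

/-- `C` is a linear locally repairable code of length `n`, dimension `k` and minimum distance `d`
with all-symbol `(r, δ)`-locality: every code symbol `j` lies in a set `S` of at most `r + δ - 1`
code symbols such that the restriction of `C` to `S` has minimum distance at least `δ`. -/
structure IsLinearLRC {ι F : Type*} [Fintype ι] [Field F] [DecidableEq F]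
    (C : Submodule F (ι → F)) (n k d r δ : ℕ) : Prop where
  one_le_r : 1 ≤ r
  r_le_k : r ≤ k
  two_le_δ : 2 ≤ δ
  length_eq : Fintype.card ι = n
  finrank_eq : Module.finrank F C = k
  minDist : HasMinDist (C : Set (ι → F)) d
  locality : ∀ j : ι, ∃ S : Finset ι, j ∈ S ∧ S.card ≤ r + δ - 1 ∧
    ∃ e : ℕ, δ ≤ e ∧ HasMinDist (restrictCode (C : Set (ι → F)) S) e

/-- `d_opt(n, k, r, δ) = n - k - (⌈k / r⌉ - 1) (δ - 1) + 1`. -/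
def dOpt (n k r δ : ℕ) : ℤ :=
  (n : ℤ) - k - (⌈(k : ℚ) / (r : ℚ)⌉ - 1) * ((δ : ℤ) - 1) + 1

/-- The linear code spanned by the rows of `G`. -/
def rowCode {F ι : Type*} [Field F] {k : ℕ} (G : Matrix (Fin k) ι F) : Submodule F (ι → F) :=
  Submodule.span F (Set.range fun a => G a)

/-- All square submatrices of `B` are invertible. -/
def AllMinorsInvertible {F : Type*} [Field F] {r s : ℕ} (B : Matrix (Fin r) (Fin s) F) : Prop :=
  ∀ (m : ℕ) (f : Fin m ↪ Fin r) (h : Fin m ↪ Fin s), IsUnit (B.submatrix f h).det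

/-- The sets `U_0, U_1, …` attached to `M = (I_r | B)`: `U_0` is the set of entries of `M`, and
`U_{m+1} = {x - y z / w | x, y, z, w ∈ U_m, w ≠ 0}`. -/
def coeffSet {F : Type*} [Field F] {r s : ℕ} (B : Matrix (Fin r) (Fin s) F) : ℕ → Set F
  | 0 => {e | ∃ a c, e = Matrix.fromCols (1 : Matrix (Fin r) (Fin r) F) B a c}
  | m + 1 => {e | ∃ x ∈ coeffSet B m, ∃ y ∈ coeffSet B m, ∃ z ∈ coeffSet B m,
      ∃ w ∈ coeffSet B m, w ≠ 0 ∧ e = x - y * z / w}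

/-- The combinations of the vectors of `g` of index less than `j`, with coefficients in `U`. -/
def combosBelow {F V : Type*} [Field F] [AddCommGroup V] [Module F V] (U : Set F) {m : ℕ}
    (g : Fin m → V) (j : Fin m) : Set V :=
  {x | ∃ u : Fin m → F, (∀ h < j, u h ∈ U) ∧ x = ∑ h ∈ Finset.Iio j, u h • g h}

/-- The combinations of the vectors of `g` of index at most `j`, with coefficients in `U` and a
nonzero coefficient at index `j`. -/
def combosUpTo {F V : Type*} [Field F] [AddCommGroup V] [Module F V] (U : Set F) {m : ℕ}
    (g : Fin m → V) (j : Fin m) : Set V :=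
  {x | ∃ u : Fin m → F, (∀ h ≤ j, u h ∈ U) ∧ u j ≠ 0 ∧ x = ∑ h ∈ Finset.Iic j, u h • g h}

/-- The index set of the columns when there are `A` blocks `S_i` of sizes `s_i = t_i + δ - 1`: block
`i` consists of `t_i` chosen vectors followed by `δ - 1` combinations of them. -/
abbrev ColIndex {A : ℕ} (t : Fin A → ℕ) (δ : ℕ) : Type :=
  Σ i : Fin A, Fin (t i) ⊕ Fin (δ - 1)

section Construction

variable {F : Type*} [Field F] {k r δ A : ℕ} {t : Fin A → ℕ}

/-- The columns: block `i` is `(g_{i,1} | … | g_{i,t_i}) (I_{t_i} | B_i')`, where `B_i'` consists of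
the first `t_i` rows of the `r × (δ - 1)` matrix `B_i`. -/
def blockCol (ht : ∀ i, t i ≤ r) (B : Fin A → Matrix (Fin r) (Fin (δ - 1)) F)
    (g : (i : Fin A) → Fin (t i) → (Fin k → F)) (c : ColIndex t δ) : Fin k → F :=
  Sum.elim (g c.1) (fun m => ∑ l : Fin (t c.1), B c.1 (Fin.castLE (ht c.1) l) m • g c.1 l) c.2

/-- The matrix `(G_1 | … | G_A)` that the construction returns. -/
def blockMatrix (ht : ∀ i, t i ≤ r) (B : Fin A → Matrix (Fin r) (Fin (δ - 1)) F)
    (g : (i : Fin A) → Fin (t i) → (Fin k → F)) : Matrix (Fin k) (ColIndex t δ) F :=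
  Matrix.of fun a c => blockCol ht B g c a

/-- `J` is a set of columns from the blocks before block `i`, with at most `t_m = s_m - δ + 1` columns
from each block `m`. -/
def IsEarlierSelection (i : Fin A) (J : Finset (ColIndex t δ)) : Prop :=
  (∀ c ∈ J, c.1 < i) ∧ ∀ m : Fin A, (J.filter fun c => c.1 = m).card ≤ t m

/-- The requirement on the vector `g i j`, given the earlier blocks and the vectors `g i l`, `l < j`.

* First block: the vectors chosen so far are linearly independent.
* First vector of a later block: it is not in the linear hull of any at most `k - 1` columns of the
  earlier blocks, at most `t_m` from each block `m`.
* Other vectors of a later block: no combination of `g i 0, …, g i j` with coefficients in `U_r`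
  and with nonzero last coefficient is in the linear hull of at most `k - 1` vectors, of which at most
  `t_m` are columns of the earlier block `m`, and the others, at most `j` of them, are combinations
  of `g i 0, …, g i (j - 1)` with coefficients in `U_r`. -/
def IsGoodChoice (ht : ∀ i, t i ≤ r) (B : Fin A → Matrix (Fin r) (Fin (δ - 1)) F)
    (g : (i : Fin A) → Fin (t i) → (Fin k → F)) (i : Fin A) (j : Fin (t i)) : Prop :=
  if (i : ℕ) = 0 then LinearIndepOn F (g i) (Set.Iic j)
  else if (j : ℕ) = 0 then
    ∀ J : Finset (ColIndex t δ), IsEarlierSelection i J → J.card ≤ k - 1 →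
      g i j ∉ Submodule.span F (blockCol ht B g '' (J : Set (ColIndex t δ)))
  else
    ∀ (J : Finset (ColIndex t δ)) (K : Finset (Fin k → F)), IsEarlierSelection i J →
      (K : Set (Fin k → F)) ⊆ combosBelow (coeffSet (B i) r) (g i) j → K.card ≤ (j : ℕ) →
      J.card + K.card ≤ k - 1 →
      ∀ x ∈ combosUpTo (coeffSet (B i) r) (g i) j,
        x ∉ Submodule.span F
          (blockCol ht B g '' (J : Set (ColIndex t δ)) ∪ (K : Set (Fin k → F)))

/-- `g` is a possible outcome of the recursive construction. -/
def IsOutcome (ht : ∀ i, t i ≤ r) (B : Fin A → Matrix (Fin r) (Fin (δ - 1)) F)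
    (g : (i : Fin A) → Fin (t i) → (Fin k → F)) : Prop :=
  ∀ (i : Fin A) (j : Fin (t i)), IsGoodChoice ht B g i j

/-- The recursive construction never gets stuck: if all choices before position `(i, j)` (block by
block) were good, then there is a good choice at position `(i, j)`. -/
def NeverStuck (k : ℕ) (ht : ∀ i, t i ≤ r) (B : Fin A → Matrix (Fin r) (Fin (δ - 1)) F) : Prop :=
  ∀ (i : Fin A) (j : Fin (t i)) (g : (i : Fin A) → Fin (t i) → (Fin k → F)),
    (∀ (i' : Fin A) (j' : Fin (t i')), i' < i ∨ (i' = i ∧ (j' : ℕ) < (j : ℕ)) →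
      IsGoodChoice ht B g i' j') →
    ∃ v : Fin k → F,
      IsGoodChoice ht B (Function.update g i (Function.update (g i) j v)) i j

/-- The matrix `G` with further columns appended, the `m`-th of them a copy of column `c m`. -/
def appendCopies {ι : Type*} (G : Matrix (Fin k) ι F) {b : ℕ} (c : Fin b → ι) :
    Matrix (Fin k) (ι ⊕ Fin b) F :=
  Matrix.fromCols G (G.submatrix id c)

end Construction

/-- `z` is the integer with `∑_{j ≤ z} (s_j - δ + 1) ≤ k - 1 < ∑_{j ≤ z + 1} (s_j - δ + 1)`, where the
block dimensions `t_j = s_j - δ + 1` are put in nondecreasing order. -/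
def IsFullBlockCount (k : ℕ) {A : ℕ} (t : Fin A → ℕ) (z : ℕ) : Prop :=
  (∑ i ∈ (Finset.univ : Finset (Fin A)).filter (fun i : Fin A => (i : ℕ) < z), t (Tuple.sort t i)) ≤ k - 1 ∧
    k - 1 < ∑ i ∈ (Finset.univ : Finset (Fin A)).filter (fun i : Fin A => (i : ℕ) < z + 1), t (Tuple.sort t i)

/-- The number `⌈n / (r + δ - 1)⌉` of blocks. -/
def numBlocks (n r δ : ℕ) : ℕ := ⌈(n : ℚ) / ((r + δ - 1 : ℕ) : ℚ)⌉₊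

/-- The standard block dimensions: with `a = ⌈n / (r + δ - 1)⌉` and `n = a (r + δ - 1) - b`, the first
`a - 1` blocks have size `r + δ - 1` and the last one has size `r + δ - 1 - b`. -/
def stdDims (n r δ : ℕ) (i : Fin (numBlocks n r δ)) : ℕ :=
  if (i : ℕ) + 1 < numBlocks n r δ then r else r - (numBlocks n r δ * (r + δ - 1) - n)

theorem stdDims_le (n r δ : ℕ) (i : Fin (numBlocks n r δ)) : stdDims n r δ i ≤ r := by
  unfold stdDims
  split_ifs
  · exact le_rfl
  · exact Nat.sub_le _ _

/-!
The heart of the matter is `linearIndepOn_blockCol`: in every outcome of the construction, any at most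
`k` columns, at most `t_m = s_m - δ + 1` of them from each block `m`, are linearly independent. One
adds the blocks one at a time. Within a block, a set of at most `t_m` columns has linearly independent
coefficient vectors, because `(I | B')` generates an MDS code (`linearIndepOn_coeffVec`). Gaussian
elimination on these vectors takes at most `r` steps, so that all coefficients that occur lie in `U_r`,
and each pivot vector is one to which the requirement on `g_{i,j}` applies
(`eq_zero_of_linearCombination_mem_span`).

The zeros of a nonzero codeword are the columns in some hyperplane, so they contain no `k` independent
columns; if `Z_m` is the set of zeros in block `m`, then `∑ min(|Z_m|, t_m) ≤ k - 1`. The surplus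
`|Z_m| - t_m ≤ δ - 1` occurs only in blocks whose dimensions add up to at most `k - 1`, hence in at most
`z` blocks, and there are at most `k - 1 + z (δ - 1)` zeros (`card_zeros_le`). A hyperplane through the
`z` smallest blocks and further chosen vectors, `k - 1` chosen vectors in all, attains this bound
(`exists_card_zeros_ge`). Locality is the MDS property of the individual blocks.

The construction never gets stuck because `|U_r| ≤ (r δ) ^ (4 ^ r)`: the requirement on a vector says
that it avoids at most `(r δ) ^ (r 4 ^ r) * (N choose (k - 1))` translates of subspaces with at most
`q ^ (k - 1)` elements each, where `N = n + (r δ) ^ ((r - 1) 4 ^ r)` bounds the number of earlier columns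
and of combinations of earlier vectors of the block (`exists_forall_smul_add_notMem_span`).
-/

/-! ### Matrices all of whose square submatrices are invertible -/

/-- A Cauchy matrix `(1 / (x_a - y_c))` with distinct nodes has all its square submatrices
invertible: a vector `v` in the kernel of one gives a polynomial `∑ v_c ∏_{e ≠ c} (X - y_e)` of degree
less than the number of its roots `x_a`, and this polynomial takes the value
`v_c ∏_{e ≠ c} (y_c - y_e)` at `y_c`. -/
theorem allMinorsInvertible_cauchy {F : Type*} [Field F] {r s : ℕ} (x : Fin r → F) (y : Fin s → F)
    (hx : Function.Injective x) (hy : Function.Injective y) (hxy : ∀ a c, x a ≠ y c) :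
    AllMinorsInvertible (Matrix.of fun a c => (x a - y c)⁻¹) := by
  classical
  intro m f h
  rw [isUnit_iff_ne_zero]
  intro hdet
  obtain ⟨v, hv0, hv⟩ := Matrix.exists_mulVec_eq_zero_iff.2 hdet
  apply hv0
  let P : Polynomial F := ∑ c, Polynomial.C (v c) *
    ∏ e ∈ Finset.univ.erase c, (Polynomial.X - Polynomial.C (y (h e)))
  have hP : P = 0 := by
    refine Polynomial.eq_zero_of_natDegree_lt_card_of_eval_eq_zero P (f := fun a : Fin m => x (f a))
      (hx.comp f.injective) (fun a => ?_) ?_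
    · have h1 := congrFun hv a
      simp only [Matrix.mulVec, dotProduct, Matrix.submatrix_apply, Matrix.of_apply,
        Pi.zero_apply] at h1
      have h2 : P.eval (x (f a)) = (∏ e, (x (f a) - y (h e))) *
          ∑ c, (x (f a) - y (h c))⁻¹ * v c := by
        simp only [P, Polynomial.eval_finsetSum, Polynomial.eval_mul, Polynomial.eval_C,
          Polynomial.eval_prod, Polynomial.eval_sub, Polynomial.eval_X, Finset.mul_sum]
        refine Finset.sum_congr rfl fun c _ => ?_
        rw [← Finset.mul_prod_erase _ _ (Finset.mem_univ c)]
        have := sub_ne_zero.2 (hxy (f a) (h c))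
        field_simp
      rw [h2, h1, mul_zero]
    · rcases Nat.eq_zero_or_pos m with rfl | hm
      · exact absurd (funext fun a => a.elim0) hv0
      · rw [Fintype.card_fin]
        refine lt_of_le_of_lt (Polynomial.natDegree_sum_le_of_forall_le (n := m - 1) _ _ fun c _ => ?_)
          (by omega)
        refine (Polynomial.natDegree_C_mul_le _ _).trans ((Polynomial.natDegree_prod_le _ _).trans ?_)
        simp
  funext c
  have h1 : P.eval (y (h c)) = v c * ∏ e ∈ Finset.univ.erase c, (y (h c) - y (h e)) := by
    simp only [P, Polynomial.eval_finsetSum, Polynomial.eval_mul, Polynomial.eval_C,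
      Polynomial.eval_prod, Polynomial.eval_sub, Polynomial.eval_X]
    refine Finset.sum_eq_single c (fun e _ hec => ?_) (by simp)
    rw [Finset.prod_eq_zero (i := c) (by simp [hec.symm]) (sub_self _), mul_zero]
  rw [hP, Polynomial.eval_zero] at h1
  refine (mul_eq_zero.1 h1.symm).resolve_right (Finset.prod_ne_zero_iff.2 fun e he => ?_)
  exact sub_ne_zero.2 fun h2 => (Finset.mem_erase.1 he).1 (h.injective (hy h2)).symm

theorem exists_allMinorsInvertible {F : Type*} [Field F] [Fintype F] {r s : ℕ}
    (h : r + s ≤ Fintype.card F) :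
    ∃ B : Matrix (Fin r) (Fin s) F, AllMinorsInvertible B := by
  obtain ⟨e⟩ : Nonempty (Fin r ⊕ Fin s ↪ F) :=
    Function.Embedding.nonempty_of_card_le (by simpa using h)
  exact ⟨_, allMinorsInvertible_cauchy (fun a => e (Sum.inl a)) (fun c => e (Sum.inr c))
    (e.injective.comp Sum.inl_injective) (e.injective.comp Sum.inr_injective)
    fun a c hac => Sum.inl_ne_inr (e.injective hac)⟩

/-- The columns of `(I_t | B')`, where `B'` consists of the first `t` rows of `B`. -/
def coeffVec {F : Type*} [Field F] {r s t : ℕ} (ht : t ≤ r) (B : Matrix (Fin r) (Fin s) F) :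
    Fin t ⊕ Fin s → Fin t → F :=
  Sum.elim (fun l => Pi.single l 1) (fun m l => B (Fin.castLE ht l) m)

/-- `(I_t | B')` generates an MDS code: any at most `t` of its columns are linearly independent. On
the rows that are not hit by the chosen unit vectors, the chosen columns of `B'` have an invertible
square submatrix. -/
theorem linearIndepOn_coeffVec {F : Type*} [Field F] {r s t : ℕ} (ht : t ≤ r)
    {B : Matrix (Fin r) (Fin s) F} (hB : AllMinorsInvertible B) (T : Finset (Fin t ⊕ Fin s))
    (hT : T.card ≤ t) : LinearIndepOn F (coeffVec ht B) (T : Set (Fin t ⊕ Fin s)) := by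
  classical
  rw [linearIndepOn_finset_iff]
  intro a ha
  -- extend the coefficients by zero, so that the relation is a sum over all columns
  let a' : Fin t ⊕ Fin s → F := fun c => if c ∈ T then a c else 0
  have hrow : ∀ l, a' (Sum.inl l) + ∑ m, a' (Sum.inr m) * B (Fin.castLE ht l) m = 0 := by
    intro l
    have h1 : ∑ c, a' c • coeffVec ht B c = 0 := by
      rw [← ha, ← Finset.sum_subset (Finset.subset_univ T)]
      · exact Finset.sum_congr rfl fun c hc => by simp [a', hc]
      · intro c _ hc
        simp [a', hc]
    have h2 := congrFun h1 l
    simpa [Fintype.sum_sum_type, coeffVec, Finset.sum_apply, Pi.single_apply] using h2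
  let L := T.toLeft
  let R := T.toRight
  have hLR : L.card + R.card = T.card := Finset.card_toLeft_add_card_toRight
  have hcard : R.card ≤ (Lᶜ).card := by
    rw [Finset.card_compl, Fintype.card_fin]; omega
  obtain ⟨Q, hQL, hQ⟩ := Finset.exists_subset_card_eq hcard
  let f : Fin R.card ↪ Fin r := (Q.orderEmbOfFin hQ).toEmbedding.trans (Fin.castLEEmb ht)
  let h : Fin R.card ↪ Fin s := (R.orderEmbOfFin rfl).toEmbedding
  have hmap : Finset.univ.map h = R := Finset.map_orderEmbOfFin_univ R rfl
  have hunit := hB R.card f h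
  have hzero : (B.submatrix f h).mulVec (fun m => a' (Sum.inr (h m))) = 0 := by
    funext l
    have hl : Q.orderEmbOfFin hQ l ∈ Lᶜ := hQL (Finset.orderEmbOfFin_mem _ _ _)
    have h1 := hrow (Q.orderEmbOfFin hQ l)
    have h2 : a' (Sum.inl (Q.orderEmbOfFin hQ l)) = 0 := by
      have : Sum.inl (Q.orderEmbOfFin hQ l) ∉ T := by
        simpa [L] using hl
      simp [a', this]
    rw [h2, zero_add] at h1
    rw [Pi.zero_apply, ← h1, Matrix.mulVec, dotProduct]
    have h3 : ∑ m, a' (Sum.inr m) * B (Fin.castLE ht (Q.orderEmbOfFin hQ l)) m =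
        ∑ m ∈ R, a' (Sum.inr m) * B (Fin.castLE ht (Q.orderEmbOfFin hQ l)) m := by
      symm
      refine Finset.sum_subset (Finset.subset_univ R) fun m _ hm => ?_
      have : Sum.inr m ∉ T := by simpa [R] using hm
      simp [a', this]
    rw [h3, ← Finset.sum_congr hmap fun _ _ => rfl, Finset.sum_map]
    refine Finset.sum_congr rfl fun m _ => ?_
    rw [Matrix.submatrix_apply, mul_comm]
    rfl
  have hR : ∀ m, a' (Sum.inr m) = 0 := by
    intro m
    by_cases hm : Sum.inr m ∈ T
    · have hmR : m ∈ R := by simpa [R] using hm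
      have h0 := Matrix.eq_zero_of_mulVec_eq_zero hunit.ne_zero hzero
      obtain ⟨m', -, rfl⟩ := Finset.mem_map.1 (hmap.symm ▸ hmR)
      exact congrFun h0 m'
    · simp [a', hm]
  intro c hc
  have hall : a' c = 0 := by
    rcases c with l | m
    · simpa [hR] using hrow l
    · exact hR m
  simpa [a', hc] using hall

/-- A nonzero word of the code generated by `(I_t | B')` has fewer than `t` zeros. -/
theorem card_zeros_lt_of_ne_zero {F : Type*} [Field F] [DecidableEq F] {r s t : ℕ} (ht : t ≤ r)
    {B : Matrix (Fin r) (Fin s) F} (hB : AllMinorsInvertible B) {y : Fin t → F} (hy : y ≠ 0) :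
    (Finset.univ.filter fun e => y ⬝ᵥ coeffVec ht B e = 0).card < t := by
  by_contra hcon
  obtain ⟨T, hT, hTc⟩ := Finset.exists_subset_card_eq (not_lt.1 hcon)
  have hli := linearIndepOn_coeffVec ht hB T hTc.le
  have hspan := LinearIndependent.span_eq_top_of_card_eq_finrank' hli (by simpa using hTc)
  apply hy
  have hker : ∀ v : Fin t → F, y ⬝ᵥ v = 0 := by
    intro v
    have hv : v ∈ Submodule.span F (Set.range fun e : (T : Set (Fin t ⊕ Fin s)) =>
        coeffVec ht B e) := by
      rw [hspan]; trivial
    have hle : Submodule.span F (Set.range fun e : (T : Set (Fin t ⊕ Fin s)) => coeffVec ht B e) ≤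
        LinearMap.ker (dotProductBilin F F y) := by
      rw [Submodule.span_le]
      rintro _ ⟨e, rfl⟩
      exact (Finset.mem_filter.1 (hT e.2)).2
    exact hle hv
  exact dotProduct_eq_zero _ hker

/-! ### Linear independence of the columns -/

section Independence

open Submodule

variable {F : Type*} [Field F]

theorem one_mem_coeffSet {r s : ℕ} (B : Matrix (Fin r) (Fin s) F) (hr : 2 ≤ r) (m : ℕ) :
    (1 : F) ∈ coeffSet B m ∧ (0 : F) ∈ coeffSet B m := by
  induction m with
  | zero =>
    exact ⟨⟨⟨0, by omega⟩, Sum.inl ⟨0, by omega⟩, by simp⟩,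
      ⟨⟨0, by omega⟩, Sum.inl ⟨1, by omega⟩, by simp⟩⟩
  | succ m ih =>
    exact ⟨⟨1, ih.1, 0, ih.2, 0, ih.2, 1, ih.1, one_ne_zero, by simp⟩,
      ⟨0, ih.2, 0, ih.2, 0, ih.2, 1, ih.1, one_ne_zero, by simp⟩⟩

/-- The sets `U_m` increase with `m`. This uses `0 ∈ U_0`, which may fail for `r = 1`. -/
theorem coeffSet_mono {r s : ℕ} (B : Matrix (Fin r) (Fin s) F) (hr : 2 ≤ r) :
    Monotone (coeffSet B) := by
  refine monotone_nat_of_le_succ fun m x hx => ?_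
  obtain ⟨h1, h0⟩ := one_mem_coeffSet B hr m
  exact ⟨x, hx, 0, h0, 0, h0, 1, h1, one_ne_zero, by simp⟩

theorem coeffVec_mem_coeffSet {r s t : ℕ} (ht : t ≤ r) (B : Matrix (Fin r) (Fin s) F)
    (e : Fin t ⊕ Fin s) (l : Fin t) : coeffVec ht B e l ∈ coeffSet B 0 := by
  rcases e with m | m
  · refine ⟨Fin.castLE ht l, Sum.inl (Fin.castLE ht m), ?_⟩
    simp [coeffVec, Pi.single_apply, Matrix.one_apply, Fin.ext_iff]
  · exact ⟨Fin.castLE ht l, Sum.inr m, by simp [coeffVec]⟩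

theorem exists_finset_subset_span_eq {t : ℕ} (T : Finset (Fin t → F)) (j : ℕ)
    (hT : ∀ c ∈ T, ∀ h : Fin t, j ≤ h → c h = 0) :
    ∃ T' ⊆ T, span F (T' : Set (Fin t → F)) = span F (T : Set (Fin t → F)) ∧ T'.card ≤ j := by
  classical
  obtain ⟨b, hbT, hspan, hli⟩ := exists_linearIndependent F (T : Set (Fin t → F))
  have hbfin : b.Finite := T.finite_toSet.subset hbT
  lift b to Finset (Fin t → F) using hbfin
  refine ⟨b, by exact_mod_cast hbT, hspan, ?_⟩
  let E : Finset (Fin t → F) :=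
    ((Finset.univ : Finset (Fin t)).filter fun h : Fin t => (h : ℕ) < j).image fun h => Pi.single h 1
  have hE : E.card ≤ j := by
    refine Finset.card_image_le.trans ?_
    calc _ = (((Finset.univ : Finset (Fin t)).filter fun h : Fin t => (h : ℕ) < j).map
          Fin.valEmbedding).card := (Finset.card_map _).symm
      _ ≤ (Finset.range j).card := Finset.card_le_card fun x hx => by
          obtain ⟨y, hy, rfl⟩ := Finset.mem_map.1 hx
          exact Finset.mem_range.2 (Finset.mem_filter.1 hy).2
      _ = j := Finset.card_range j
  have h1 := linearIndependent_le_span_aux' _ hli (E : Set (Fin t → F)) ?_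
  · simpa using h1.trans (by simpa using hE)
  · rintro _ ⟨⟨c, hc⟩, rfl⟩
    have hcT := hbT hc
    change c ∈ _
    rw [pi_eq_sum_univ' c]
    refine sum_mem fun h _ => ?_
    by_cases hh : (h : ℕ) < j
    · refine smul_mem _ _ (subset_span ?_)
      refine Finset.mem_coe.2 (Finset.mem_image.2 ⟨h, by simp [hh], ?_⟩)
      funext l
      simp [Pi.single_apply, eq_comm]
    · rw [hT c hcT h (not_lt.1 hh), zero_smul]
      exact zero_mem _

variable {k r δ A : ℕ} {t : Fin A → ℕ} {ht : ∀ i, t i ≤ r}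
  {B : Fin A → Matrix (Fin r) (Fin (δ - 1)) F} {g : (i : Fin A) → Fin (t i) → (Fin k → F)}

theorem blockCol_eq (i : Fin A) (e : Fin (t i) ⊕ Fin (δ - 1)) :
    blockCol ht B g ⟨i, e⟩ = Fintype.linearCombination F (g i) (coeffVec (ht i) (B i) e) := by
  rcases e with m | m
  · simp [blockCol, coeffVec, Fintype.linearCombination_apply, Pi.single_apply]
  · simp [blockCol, coeffVec, Fintype.linearCombination_apply]

/-- The two requirements on the vectors of a later block in one form. For `j = 0` there are no
combinations of earlier vectors of the block, and membership in `U_r` plays no role. -/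
theorem linearCombination_notMem_span {i : Fin A} {j : Fin (t i)} (hi : (i : ℕ) ≠ 0)
    (hg : IsGoodChoice ht B g i j) {J : Finset (ColIndex t δ)} (hJ : IsEarlierSelection i J)
    (T : Finset (Fin (t i) → F)) (hTj : T.card ≤ j) (hJT : J.card + T.card ≤ k - 1)
    (hT : ∀ c ∈ T, ∀ h, j ≤ h → c h = 0)
    (hTU : (j : ℕ) ≠ 0 → ∀ c ∈ T, ∀ h, c h ∈ coeffSet (B i) r)
    {p : Fin (t i) → F} (hpj : p j ≠ 0) (hp : ∀ h, j < h → p h = 0)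
    (hpU : (j : ℕ) ≠ 0 → ∀ h, p h ∈ coeffSet (B i) r) :
    Fintype.linearCombination F (g i) p ∉
      span F (blockCol ht B g '' (J : Set (ColIndex t δ)) ∪
        Fintype.linearCombination F (g i) '' (T : Set (Fin (t i) → F))) := by
  classical
  unfold IsGoodChoice at hg
  rw [if_neg hi] at hg
  split_ifs at hg with hj
  · have hT0 : T = ∅ := Finset.card_eq_zero.1 (by omega)
    subst hT0
    have hpg : Fintype.linearCombination F (g i) p = p j • g i j := by
      rw [Fintype.linearCombination_apply]
      refine Finset.sum_eq_single j (fun h _ hh => ?_) (by simp)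
      rw [hp h (lt_of_le_of_ne (by rw [Fin.le_def]; omega) hh.symm), zero_smul]
    rw [hpg]
    intro hmem
    rw [Finset.coe_empty, Set.image_empty, Set.union_empty, smul_mem_iff _ hpj] at hmem
    exact hg J hJ (by simpa using hJT) hmem
  · have hcard : (T.image (Fintype.linearCombination F (g i))).card ≤ T.card :=
      Finset.card_image_le
    have h1 := hg J (T.image (Fintype.linearCombination F (g i))) hJ ?_ (by omega) (by omega)
      (Fintype.linearCombination F (g i) p) ?_
    · rwa [Finset.coe_image] at h1
    · intro x hx
      obtain ⟨c, hc, rfl⟩ := Finset.mem_image.1 (Finset.mem_coe.1 hx)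
      refine ⟨c, fun h _ => hTU hj c hc h, ?_⟩
      rw [Fintype.linearCombination_apply]
      refine (Finset.sum_subset (Finset.subset_univ _) fun h _ hh => ?_).symm
      rw [hT c hc h (by simpa using hh), zero_smul]
    · refine ⟨p, fun h _ => hpU hj h, hpj, ?_⟩
      rw [Fintype.linearCombination_apply]
      refine (Finset.sum_subset (Finset.subset_univ _) fun h _ hh => ?_).symm
      rw [hp h (by simpa using hh), zero_smul]

/-- Gaussian elimination within a later block. For a finite set `T` of coefficient vectors, a
combination `w` of them whose value `∑ w_h g_{i,h}` lies in the span of an earlier selection `J` must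
vanish. By induction on the bound `j` for the supports of the vectors in `T`: if some `p ∈ T` has
`p_j ≠ 0`, subtracting multiples of `p` clears position `j` in the others, at the price of passing
from `U_s` to `U_{s+1}`. The requirement on `g_{i,j}` shows that `p` does not occur in `w`. -/
theorem eq_zero_of_linearCombination_mem_span {i : Fin A} (hi : (i : ℕ) ≠ 0)
    (hg : ∀ j, IsGoodChoice ht B g i j) {J : Finset (ColIndex t δ)} (hJ : IsEarlierSelection i J)
    (j : ℕ) : ∀ (s : ℕ) (T : Finset (Fin (t i) → F)), j ≤ t i → s + j ≤ r →
      (∀ c ∈ T, ∀ h, c h ∈ coeffSet (B i) s) →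
      (∀ c ∈ T, ∀ h : Fin (t i), j ≤ h → c h = 0) → J.card + T.card ≤ k →
      ∀ w ∈ span F (T : Set (Fin (t i) → F)), Fintype.linearCombination F (g i) w ∈
        span F (blockCol ht B g '' (J : Set (ColIndex t δ))) → w = 0 := by
  classical
  induction j with
  | zero =>
    intro s T _ _ _ hT _ w hw _
    have : span F (T : Set (Fin (t i) → F)) ≤ ⊥ := by
      rw [span_le]
      intro c hc
      exact funext fun h => hT c hc h (Nat.zero_le _)
    exact this hw
  | succ j ih =>
    intro s T hjt hsr hTU hT hJT w hw hwJ
    let j' : Fin (t i) := ⟨j, hjt⟩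
    by_cases hpiv : ∀ c ∈ T, c j' = 0
    · refine ih s T (by omega) (by omega) hTU (fun c hc h hh => ?_) hJT w hw hwJ
      rcases eq_or_lt_of_le hh with heq | hlt
      · rw [show h = j' from Fin.ext heq.symm]
        exact hpiv c hc
      · exact hT c hc h hlt
    push Not at hpiv
    obtain ⟨p, hpT, hpj⟩ := hpiv
    let T₁ := (T.erase p).image fun c => c - (c j' / p j') • p
    have hT₁card : T₁.card + 1 ≤ T.card := by
      have := Finset.card_erase_add_one hpT
      have : T₁.card ≤ (T.erase p).card := Finset.card_image_le
      omega
    have hT₁ : ∀ c ∈ T₁, ∀ h : Fin (t i), j ≤ h → c h = 0 := by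
      intro c hc h hh
      obtain ⟨c, hcT, rfl⟩ := Finset.mem_image.1 hc
      rcases eq_or_lt_of_le hh with heq | hlt
      · rw [show h = j' from Fin.ext heq.symm]
        simp [hpj]
      · simp [hT c (Finset.mem_of_mem_erase hcT) h hlt, hT p hpT h hlt]
    have hT₁U : ∀ c ∈ T₁, ∀ h, c h ∈ coeffSet (B i) (s + 1) := by
      intro c hc h
      obtain ⟨c, hc', rfl⟩ := Finset.mem_image.1 hc
      have hcT := Finset.mem_of_mem_erase hc'
      refine ⟨c h, hTU c hcT h, c j', hTU c hcT j', p h, hTU p hpT h, p j', hTU p hpT j', hpj, ?_⟩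
      simp only [Pi.sub_apply, Pi.smul_apply, smul_eq_mul]
      ring
    obtain ⟨T₂, hT₂T₁, hspan, hT₂card⟩ := exists_finset_subset_span_eq T₁ j hT₁
    have hT₂T₁card := Finset.card_le_card hT₂T₁
    have hr2 : j ≠ 0 → 2 ≤ r := by omega
    have hnot := linearCombination_notMem_span (j := j') hi (hg j') hJ T₂ hT₂card (by omega)
      (fun c hc => hT₁ c (hT₂T₁ hc))
      (fun hj c hc h => coeffSet_mono (B i) (hr2 hj) (by omega) (hT₁U c (hT₂T₁ hc) h)) hpj
      (hT p hpT) (fun hj h => coeffSet_mono (B i) (hr2 hj) (by omega) (hTU p hpT h))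
    have hTspan : span F (T : Set (Fin (t i) → F)) ≤ span F (insert p (T₂ : Set (Fin (t i) → F))) := by
      rw [span_insert, hspan, ← span_insert, span_le]
      intro c hc
      by_cases hcp : c = p
      · exact subset_span (Or.inl hcp)
      · rw [SetLike.mem_coe, mem_span_insert]
        refine ⟨c j' / p j', c - (c j' / p j') • p, subset_span ?_, by abel⟩
        exact Finset.mem_coe.2 (Finset.mem_image.2 ⟨c, Finset.mem_erase.2 ⟨hcp, hc⟩, rfl⟩)
    obtain ⟨a, w', hw', rfl⟩ := mem_span_insert.1 (hTspan hw)
    have ha : a = 0 := by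
      by_contra ha
      apply hnot
      rw [span_union, span_image]
      rw [map_add, map_smul] at hwJ
      rw [← smul_mem_iff _ ha, ← add_sub_cancel_right (a • _) (Fintype.linearCombination F (g i) w')]
      exact sub_mem (mem_sup_left hwJ) (mem_sup_right (mem_map_of_mem hw'))
    subst ha
    rw [zero_smul, zero_add] at hwJ ⊢
    exact ih (s + 1) T₁ (by omega) (by omega) hT₁U hT₁ (by omega) w' (hspan ▸ hw') hwJ

/-- The key property of an outcome: any at most `k` columns, at most `t_m` of them from each block `m`,
are linearly independent. -/
theorem linearIndepOn_blockCol (hB : ∀ i, AllMinorsInvertible (B i)) (hg : IsOutcome ht B g)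
    (J : Finset (ColIndex t δ)) (hJ : ∀ m, (J.filter fun c => c.1 = m).card ≤ t m)
    (hJk : J.card ≤ k) : LinearIndepOn F (blockCol ht B g) (J : Set (ColIndex t δ)) := by
  classical
  -- induction on the number `N` of blocks that are met
  suffices h : ∀ N : ℕ, ∀ J : Finset (ColIndex t δ),
      (∀ m, (J.filter fun c => c.1 = m).card ≤ t m) → J.card ≤ k → (∀ c ∈ J, (c.1 : ℕ) < N) →
      LinearIndepOn F (blockCol ht B g) (J : Set (ColIndex t δ)) from
    h A J hJ hJk fun c _ => c.1.2
  intro N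
  induction N with
  | zero =>
    intro J _ _ hN
    have : J = ∅ := Finset.eq_empty_of_forall_notMem fun c hc => absurd (hN c hc) (by omega)
    subst this
    rw [Finset.coe_empty]
    exact linearIndepOn_empty _ _
  | succ N ih =>
    intro J hJ hJk hN
    by_cases hNA : N < A
    swap
    · exact ih J hJ hJk fun c _ => c.1.2.trans_le (not_lt.1 hNA)
    let i : Fin A := ⟨N, hNA⟩
    let J' := J.filter fun c => c.1 ≠ i
    let T := (Finset.univ : Finset (Fin (t i) ⊕ Fin (δ - 1))).filter fun e => (⟨i, e⟩ : ColIndex t δ) ∈ J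
    let φ : Fin (t i) ⊕ Fin (δ - 1) ↪ ColIndex t δ :=
      Function.Embedding.sigmaMk (β := fun i => Fin (t i) ⊕ Fin (δ - 1)) i
    have hTJ : T.map φ = J.filter fun c => c.1 = i := by
      ext ⟨m, e⟩
      simp only [Finset.mem_map, Finset.mem_filter, T, Finset.mem_univ, true_and,
        φ, Function.Embedding.sigmaMk_apply]
      constructor
      · rintro ⟨e', he', h⟩
        obtain ⟨rfl, h⟩ := Sigma.mk.inj h
        obtain rfl := eq_of_heq h
        exact ⟨he', rfl⟩
      · rintro ⟨h, rfl⟩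
        exact ⟨e, h, rfl⟩
    have hTt : T.card ≤ t i := by
      rw [← Finset.card_map φ, hTJ]
      exact hJ i
    have hsplit : J'.card + T.card = J.card := by
      rw [← Finset.card_map φ (s := T), hTJ, add_comm]
      exact Finset.card_filter_add_card_filter_not _
    have hlt : ∀ c ∈ J', c.1 < i := by
      intro c hc
      have h1 := hN c (Finset.mem_filter.1 hc).1
      have h2 : (c.1 : ℕ) ≠ N := fun h => (Finset.mem_filter.1 hc).2 (Fin.ext h)
      rw [Fin.lt_def]
      change (c.1 : ℕ) < N
      omega
    have hJ' : IsEarlierSelection i J' := by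
      refine ⟨hlt, fun m => (Finset.card_le_card ?_).trans (hJ m)⟩
      exact Finset.filter_subset_filter _ (Finset.filter_subset _ _)
    have hli' := ih J' hJ'.2 (by omega) hlt
    rw [linearIndepOn_finset_iff] at hli' ⊢
    intro a ha
    have hliT := linearIndepOn_coeffVec (ht i) (hB i) T hTt
    rw [linearIndepOn_finset_iff] at hliT
    let w : Fin (t i) → F := ∑ e ∈ T, a ⟨i, e⟩ • coeffVec (ht i) (B i) e
    have hsum : Fintype.linearCombination F (g i) w + ∑ c ∈ J', a c • blockCol ht B g c = 0 := by
      rw [← ha, ← Finset.sum_filter_add_sum_filter_not J (fun c => c.1 = i), ← hTJ, Finset.sum_map,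
        map_sum]
      simp only [map_smul, φ, Function.Embedding.sigmaMk_apply, blockCol_eq, J']
    have hw0 : w = 0 := by
      by_cases hi : (i : ℕ) = 0
      · -- first block: the chosen vectors are linearly independent and `J'` is empty
        have hJ'0 : J' = ∅ := Finset.eq_empty_of_forall_notMem fun c hc => by
          have := Fin.lt_def.1 (hlt c hc)
          omega
        rw [hJ'0, Finset.sum_empty, add_zero, Fintype.linearCombination_apply] at hsum
        funext l
        have h1 := hg i ⟨t i - 1, by have := l.2; omega⟩
        unfold IsGoodChoice at h1
        rw [if_pos hi] at h1
        have h2 : (Set.Iic (⟨t i - 1, by have := l.2; omega⟩ : Fin (t i))) = Set.univ :=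
          Set.eq_univ_of_forall fun x => by
            rw [Set.mem_Iic, Fin.le_def]
            have := x.2
            change (x : ℕ) ≤ t i - 1
            omega
        rw [h2, linearIndepOn_univ_iff, Fintype.linearIndependent_iff] at h1
        exact h1 w hsum l
      · refine eq_zero_of_linearCombination_mem_span hi (hg i) hJ' (t i) 0
          (T.image (coeffVec (ht i) (B i))) le_rfl (by have := ht i; omega) ?_ ?_ ?_ w ?_ ?_
        · intro c hc h
          obtain ⟨e, _, rfl⟩ := Finset.mem_image.1 hc
          exact coeffVec_mem_coeffSet _ _ _ _
        · intro c _ h hh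
          exact absurd h.2 (by omega)
        · have : (T.image (coeffVec (ht i) (B i))).card ≤ T.card := Finset.card_image_le
          omega
        · refine sum_mem fun e he => smul_mem _ _ (subset_span ?_)
          exact Finset.mem_coe.2 (Finset.mem_image_of_mem _ he)
        · rw [eq_neg_of_add_eq_zero_left hsum]
          exact neg_mem (sum_mem fun c hc => smul_mem _ _ (subset_span (Set.mem_image_of_mem _ hc)))
    have haT := hliT (fun e => a ⟨i, e⟩) hw0
    rw [hw0, map_zero, zero_add] at hsum
    have haJ' := hli' a hsum
    rintro ⟨m, e⟩ hc
    by_cases hm : m = i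
    · subst hm
      exact haT e (by simpa [T] using hc)
    · exact haJ' ⟨m, e⟩ (Finset.mem_filter.2 ⟨hc, hm⟩)

end Independence

open Matrix

/-! ### Codes spanned by the rows of a matrix -/

section RowCode

variable {F ι : Type*} [Field F]

theorem mem_rowCode {k : ℕ} {G : Matrix (Fin k) ι F} {w : ι → F} :
    w ∈ rowCode G ↔ ∃ x : Fin k → F, x ᵥ* G = w := by
  have h : rowCode G = LinearMap.range G.vecMulLinear := (range_vecMulLinear G).symm
  rw [h, LinearMap.mem_range]
  rfl

theorem finrank_rowCode {k : ℕ} {G : Matrix (Fin k) ι F}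
    (hG : ∀ x : Fin k → F, x ᵥ* G = 0 → x = 0) : Module.finrank F (rowCode G) = k := by
  have h : rowCode G = LinearMap.range G.vecMulLinear := (range_vecMulLinear G).symm
  rw [h, LinearMap.finrank_range_of_inj ((injective_iff_map_eq_zero _).2 hG)]
  simp

variable [Fintype ι] [DecidableEq F]

theorem hammingNorm_add_card_zeros (w : ι → F) :
    hammingNorm w + (Finset.univ.filter fun c => w c = 0).card = Fintype.card ι := by
  rw [hammingNorm, add_comm, Finset.card_filter_add_card_filter_not, Finset.card_univ]

/-- The minimum distance of a linear code is its minimum nonzero weight. -/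
theorem hasMinDist_of_hammingNorm {C : Submodule F (ι → F)} {d : ℕ}
    (h₁ : ∃ w ∈ C, w ≠ 0 ∧ hammingNorm w = d) (h₂ : ∀ w ∈ C, w ≠ 0 → d ≤ hammingNorm w) :
    HasMinDist (C : Set (ι → F)) d := by
  constructor
  · obtain ⟨w, hw, hw0, hwd⟩ := h₁
    exact ⟨w, hw, 0, C.zero_mem, hw0, by rw [hammingDist_zero_right, hwd]⟩
  · rintro e ⟨x, hx, y, hy, hxy, rfl⟩
    rw [hammingDist_eq_hammingNorm, neg_add_eq_sub]
    exact h₂ _ (C.sub_mem hy hx) (sub_ne_zero.2 hxy.symm)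

theorem exists_hasMinDist_of_le_hammingNorm {C : Submodule F (ι → F)} {d : ℕ}
    (h₁ : ∃ w ∈ C, w ≠ 0) (h₂ : ∀ w ∈ C, w ≠ 0 → d ≤ hammingNorm w) :
    ∃ e, d ≤ e ∧ HasMinDist (C : Set (ι → F)) e := by
  classical
  have hex : ∃ e, ∃ w ∈ C, w ≠ 0 ∧ hammingNorm w = e := by
    obtain ⟨w, hw, hw0⟩ := h₁
    exact ⟨_, w, hw, hw0, rfl⟩
  refine ⟨Nat.find hex, ?_, hasMinDist_of_hammingNorm (Nat.find_spec hex) fun w hw hw0 =>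
    Nat.find_min' hex ⟨w, hw, hw0, rfl⟩⟩
  obtain ⟨w, hw, hw0, he⟩ := Nat.find_spec hex
  exact he ▸ h₂ w hw hw0

end RowCode

/-- Locality: if the columns of `G` indexed by the image of `φ` are those of
`(g_1 | ⋯ | g_t) (I_t | B')`, then the code restricted to this image has minimum distance at least
`δ`. Letting `φ` vary covers both the blocks themselves and blocks with a column replaced by a copy
of it. -/
theorem hasMinDist_restrictCode_map {F ι : Type*} [Field F] [DecidableEq F] {k r δ t : ℕ} (hδ : 1 ≤ δ) (ht : t ≤ r)
    {B : Matrix (Fin r) (Fin (δ - 1)) F} (hB : AllMinorsInvertible B) (g : Fin t → Fin k → F)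
    (hg : ∃ l, g l ≠ 0) (G : Matrix (Fin k) ι F) (φ : Fin t ⊕ Fin (δ - 1) ↪ ι)
    (hφ : ∀ e a, G a (φ e) = Fintype.linearCombination F g (coeffVec ht B e) a) :
    ∃ e, δ ≤ e ∧
      HasMinDist (restrictCode (rowCode G : Set (ι → F)) (Finset.univ.map φ)) e := by
  classical
  have hval : ∀ x e, (x ᵥ* G) (φ e) = (fun l => x ⬝ᵥ g l) ⬝ᵥ coeffVec ht B e := by
    intro x e
    have : (x ᵥ* G) (φ e) = dotProductBilin F F x (Fintype.linearCombination F g (coeffVec ht B e)) :=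
      congrArg (x ⬝ᵥ ·) (funext (hφ e))
    rw [this, Fintype.linearCombination_apply, map_sum, dotProduct]
    refine Finset.sum_congr rfl fun l _ => ?_
    rw [map_smul, smul_eq_mul, mul_comm]
    rfl
  let ρ : (ι → F) →ₗ[F] (Finset.univ.map φ → F) :=
    LinearMap.funLeft F F (Subtype.val : Finset.univ.map φ → ι)
  have hC : restrictCode (rowCode G : Set (ι → F)) (Finset.univ.map φ) =
      ((rowCode G).map ρ : Set (Finset.univ.map φ → F)) := by
    rw [Submodule.map_coe]
    rfl
  rw [hC]
  have hmem : ∀ e, φ e ∈ Finset.univ.map φ := fun e => Finset.mem_map_of_mem φ (Finset.mem_univ e)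
  refine exists_hasMinDist_of_le_hammingNorm ?_ ?_
  · obtain ⟨l, hl⟩ := hg
    obtain ⟨a, ha⟩ := Function.ne_iff.1 hl
    refine ⟨_, Submodule.mem_map_of_mem (mem_rowCode.2 ⟨Pi.single a 1, rfl⟩), fun h0 => ha ?_⟩
    have h1 := congrFun h0 ⟨φ (Sum.inl l), hmem _⟩
    have h2 : (Pi.single a (1 : F) ᵥ* G) (φ (Sum.inl l)) = 0 := h1
    rw [Matrix.single_one_vecMul, Matrix.row_apply, hφ] at h2
    simpa [coeffVec, Fintype.linearCombination_apply, Pi.single_apply, ite_apply] using h2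
  · rintro _ ⟨w, hw, rfl⟩ hw0
    obtain ⟨x, rfl⟩ := mem_rowCode.1 hw
    have hy : (fun l => x ⬝ᵥ g l) ≠ 0 := by
      intro hy
      apply hw0
      funext ⟨c, hc⟩
      obtain ⟨e, -, rfl⟩ := Finset.mem_map.1 hc
      change (x ᵥ* G) (φ e) = 0
      rw [hval, hy, zero_dotProduct]
    have h1 := card_zeros_lt_of_ne_zero ht hB hy
    have h2 := hammingNorm_add_card_zeros (fun e => (x ᵥ* G) (φ e))
    have h3 : hammingNorm (fun e => (x ᵥ* G) (φ e)) ≤ hammingNorm (ρ (x ᵥ* G)) := by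
      refine Finset.card_le_card_of_injOn (fun e => ⟨φ e, hmem e⟩) (fun e he => ?_)
        fun e _ e' _ h => φ.injective (congrArg Subtype.val h)
      exact Finset.mem_coe.2 (Finset.mem_filter.2 ⟨Finset.mem_univ _, (Finset.mem_filter.1 he).2⟩)
    simp only [hval, Fintype.card_sum, Fintype.card_fin] at h2
    simp only [hval] at h3
    omega

/-! ### The minimum distance -/

section MinDist

/-- The `z` smallest values have the least sum among all choices of `z` values. -/
theorem sum_sort_le_sum {A : ℕ} (t : Fin A → ℕ) (I : Finset (Fin A)) :
    ∑ i ∈ (Finset.univ : Finset (Fin A)).filter (fun i : Fin A => (i : ℕ) < I.card),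
      t (Tuple.sort t i) ≤ ∑ i ∈ I, t i := by
  let σ := Tuple.sort t
  let I' := I.map σ.symm.toEmbedding
  have hI' : I'.card = I.card := Finset.card_map _
  have hsum : ∑ i ∈ I, t i = ∑ i ∈ I', t (σ i) := by
    rw [Finset.sum_map]
    simp
  rw [hsum]
  let e := I'.orderEmbOfFin hI'
  have hle : ∀ (m : ℕ) (hm : m < I.card), m ≤ (e ⟨m, hm⟩ : ℕ) := by
    intro m
    induction m with
    | zero => intro _; exact Nat.zero_le _
    | succ m ih =>
      intro hm
      have h1 := ih (by omega)
      have h2 : e ⟨m, by omega⟩ < e ⟨m + 1, hm⟩ := e.strictMono (by simp [Fin.lt_def])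
      rw [Fin.lt_def] at h2
      omega
  have hIA : I.card ≤ A := by simpa using Finset.card_le_univ I
  have hf : (Finset.univ : Finset (Fin A)).filter (fun i : Fin A => (i : ℕ) < I.card) =
      Finset.univ.map (Fin.castLEEmb hIA) := by
    ext i
    simp only [Finset.mem_filter, Finset.mem_univ, true_and, Finset.mem_map]
    exact ⟨fun h => ⟨⟨i, h⟩, rfl⟩, by rintro ⟨j, rfl⟩; exact j.2⟩
  have hmap : Finset.univ.map e.toEmbedding = I' := Finset.map_orderEmbOfFin_univ I' hI'
  rw [hf, ← hmap, Finset.sum_map, Finset.sum_map]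
  exact Finset.sum_le_sum fun i _ => Tuple.monotone_sort t (Fin.le_def.2 (hle i i.2))

theorem exists_isFullBlockCount {k A : ℕ} {t : Fin A → ℕ} (hk : 1 ≤ k) (hsum : k ≤ ∑ i, t i) :
    ∃! z : ℕ, IsFullBlockCount k t z := by
  classical
  let f : ℕ → ℕ := fun z =>
    ∑ i ∈ (Finset.univ : Finset (Fin A)).filter (fun i : Fin A => (i : ℕ) < z), t (Tuple.sort t i)
  have hf : Monotone f := fun z z' hz => Finset.sum_le_sum_of_subset fun i hi => by
    simp only [Finset.mem_filter, Finset.mem_univ, true_and] at hi ⊢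
    omega
  have hex : ∃ z, k - 1 < f z := by
    refine ⟨A, ?_⟩
    have : f A = ∑ i, t i := by
      simp only [f, Fin.is_lt, Finset.filter_true]
      exact Equiv.sum_comp (Tuple.sort t) t
    omega
  have hpos : Nat.find hex ≠ 0 := by
    intro h0
    have := Nat.find_spec hex
    rw [h0] at this
    simp [f] at this
  refine ⟨Nat.find hex - 1, ⟨not_lt.1 (Nat.find_min hex (by omega)), ?_⟩, ?_⟩
  · rw [Nat.sub_add_cancel (by omega)]
    exact Nat.find_spec hex
  · rintro z ⟨h1, h2⟩
    have h3 : Nat.find hex ≤ z + 1 := Nat.find_min' hex h2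
    have h4 : z < Nat.find hex := by
      by_contra h
      exact absurd (Nat.find_spec hex) (not_lt.2 ((hf (not_lt.1 h)).trans h1))
    omega

theorem IsFullBlockCount.card_le {k A : ℕ} {t : Fin A → ℕ} {z : ℕ} (hz : IsFullBlockCount k t z)
    {I : Finset (Fin A)} (hI : ∑ i ∈ I, t i ≤ k - 1) : I.card ≤ z := by
  by_contra h
  obtain ⟨I', hI', hc⟩ := Finset.exists_subset_card_eq (show z + 1 ≤ I.card by omega)
  have h1 := sum_sort_le_sum t I'
  rw [hc] at h1
  have h2 : ∑ i ∈ I', t i ≤ ∑ i ∈ I, t i := Finset.sum_le_sum_of_subset hI'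
  have := hz.2
  omega

/-- The `z` smallest blocks fit into dimension `k - 1`. -/
theorem IsFullBlockCount.exists_blocks {k A : ℕ} {t : Fin A → ℕ} {z : ℕ}
    (hz : IsFullBlockCount k t z) : ∃ I : Finset (Fin A), I.card = z ∧ ∑ i ∈ I, t i ≤ k - 1 := by
  have hzA : z < A := by
    by_contra h
    have h1 := hz.1.trans_lt hz.2
    rw [Finset.filter_true_of_mem fun i _ => by have := i.2; omega,
      Finset.filter_true_of_mem fun i _ => by have := i.2; omega] at h1
    exact lt_irrefl _ h1
  refine ⟨((Finset.univ : Finset (Fin A)).filter (fun i : Fin A => (i : ℕ) < z)).map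
    (Tuple.sort t).toEmbedding, ?_, ?_⟩
  · rw [Finset.card_map, ← Finset.card_map Fin.valEmbedding]
    convert Finset.card_range z
    ext m
    simp only [Finset.mem_map, Finset.mem_filter, Finset.mem_univ, true_and, Finset.mem_range,
      Fin.valEmbedding_apply]
    exact ⟨by rintro ⟨i, hi, rfl⟩; exact hi, fun h => ⟨⟨m, by omega⟩, h, rfl⟩⟩
  · rw [Finset.sum_map]
    exact hz.1

variable {F : Type*} [Field F] {k r δ A : ℕ} {t : Fin A → ℕ} {ht : ∀ i, t i ≤ r}
  {B : Fin A → Matrix (Fin r) (Fin (δ - 1)) F} {g : (i : Fin A) → Fin (t i) → (Fin k → F)}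

theorem exists_selection (Z : Finset (ColIndex t δ)) {N : ℕ}
    (hN : N ≤ ∑ m, min (Z.filter fun c => c.1 = m).card (t m)) :
    ∃ J ⊆ Z, J.card = N ∧ ∀ m, (J.filter fun c => c.1 = m).card ≤ t m := by
  classical
  choose Y hYZ hY using fun m => Finset.exists_subset_card_eq
    (min_le_left (Z.filter fun c => c.1 = m).card (t m))
  have hYm : ∀ m, ∀ c ∈ Y m, c.1 = m := fun m c hc => (Finset.mem_filter.1 (hYZ m hc)).2
  have hcard : (Finset.univ.biUnion Y).card = ∑ m, min (Z.filter fun c => c.1 = m).card (t m) := by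
    rw [Finset.card_biUnion]
    · exact Finset.sum_congr rfl fun m _ => hY m
    · intro m _ m' _ hmm'
      rw [Function.onFun, Finset.disjoint_left]
      exact fun c hc hc' => hmm' ((hYm m c hc).symm.trans (hYm m' c hc'))
  obtain ⟨J, hJY, hJ⟩ := Finset.exists_subset_card_eq (hN.trans hcard.ge)
  refine ⟨J, fun c hc => ?_, hJ, fun m => ?_⟩
  · obtain ⟨m, -, hm⟩ := Finset.mem_biUnion.1 (hJY hc)
    exact (Finset.mem_filter.1 (hYZ m hm)).1
  · calc _ ≤ (Y m).card := Finset.card_le_card fun c hc => by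
          obtain ⟨hcJ, hcm⟩ := Finset.mem_filter.1 hc
          obtain ⟨m', -, hm'⟩ := Finset.mem_biUnion.1 (hJY hcJ)
          rwa [← hcm, hYm m' c hm']
      _ ≤ t m := by rw [hY]; exact min_le_right _ _

theorem outcome_ne_zero (hk : 1 ≤ k) (hB : ∀ i, AllMinorsInvertible (B i))
    (hg : IsOutcome ht B g) (i : Fin A) (l : Fin (t i)) : g i l ≠ 0 := by
  classical
  have h := linearIndepOn_blockCol hB hg {⟨i, Sum.inl l⟩} (fun m => ?_) (by simpa using hk)
  · rw [Finset.coe_singleton] at h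
    exact h.ne_zero (Set.mem_singleton (⟨i, Sum.inl l⟩ : ColIndex t δ))
  · by_cases hm : i = m
    · subst hm
      exact (Finset.card_filter_le _ _).trans (by rw [Finset.card_singleton]; have := l.2; omega)
    · simp [Finset.filter_singleton, hm]

variable [DecidableEq F]

/-- The zeros of a nonzero codeword lie in a hyperplane, which contains no `k` independent columns. -/
theorem sum_min_card_zeros_lt (hB : ∀ i, AllMinorsInvertible (B i)) (hg : IsOutcome ht B g)
    {x : Fin k → F} (hx : x ≠ 0) :
    ∑ m, min ((Finset.univ.filter fun c => (x ᵥ* blockMatrix ht B g) c = 0).filter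
      fun c => c.1 = m).card (t m) < k := by
  classical
  by_contra hcon
  obtain ⟨J, hJZ, hJk, hJ⟩ := exists_selection _ (not_lt.1 hcon)
  have hli := linearIndepOn_blockCol hB hg J hJ hJk.le
  have hspan := LinearIndependent.span_eq_top_of_card_eq_finrank' hli (by simpa using hJk)
  apply hx
  have hle : Submodule.span F (Set.range fun c : (J : Set (ColIndex t δ)) => blockCol ht B g c) ≤
      LinearMap.ker (dotProductBilin F F x) := by
    rw [Submodule.span_le]
    rintro _ ⟨c, rfl⟩
    exact (Finset.mem_filter.1 (hJZ c.2)).2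
  rw [hspan] at hle
  exact dotProduct_eq_zero _ fun v => hle (Submodule.mem_top (x := v))

theorem card_filter_fst_le (Z : Finset (ColIndex t δ)) (m : Fin A) :
    (Z.filter fun c => c.1 = m).card ≤ t m + (δ - 1) := by
  classical
  calc _ ≤ ((Finset.univ : Finset (Fin (t m) ⊕ Fin (δ - 1))).image
        fun e => (⟨m, e⟩ : ColIndex t δ)).card := Finset.card_le_card (by
        rintro ⟨m', e⟩ hc
        obtain rfl : m' = m := (Finset.mem_filter.1 hc).2
        exact Finset.mem_image_of_mem _ (Finset.mem_univ e))
    _ ≤ _ := Finset.card_image_le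
    _ = _ := by simp

/-- A nonzero codeword has at most `k - 1 + z (δ - 1)` zeros: beyond their rank, which is at most
`k - 1`, the zeros can have `δ - 1` further elements only in blocks of which they contain a basis. -/
theorem card_zeros_le (hB : ∀ i, AllMinorsInvertible (B i)) (hg : IsOutcome ht B g)
    {z : ℕ} (hz : IsFullBlockCount k t z) {x : Fin k → F} (hx : x ≠ 0) :
    (Finset.univ.filter fun c => (x ᵥ* blockMatrix ht B g) c = 0).card ≤ k - 1 + z * (δ - 1) := by
  classical
  have h1 := sum_min_card_zeros_lt hB hg hx
  set Z := Finset.univ.filter fun c => (x ᵥ* blockMatrix ht B g) c = 0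
  let I := Finset.univ.filter fun m => t m ≤ (Z.filter fun c => c.1 = m).card
  have hI : I.card ≤ z := by
    refine hz.card_le (le_trans ?_ (Nat.le_sub_one_of_lt h1))
    calc ∑ i ∈ I, t i ≤ ∑ i ∈ I, min (Z.filter fun c => c.1 = i).card (t i) :=
          Finset.sum_le_sum fun i hi => le_min (Finset.mem_filter.1 hi).2 le_rfl
      _ ≤ _ := Finset.sum_le_sum_of_subset (Finset.subset_univ _)
  have h2 : Z.card = ∑ m, (Z.filter fun c => c.1 = m).card :=
    Finset.card_eq_sum_card_fiberwise fun c _ => Finset.mem_coe.2 (Finset.mem_univ _)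
  have h3 : Z.card ≤ ∑ m, (min (Z.filter fun c => c.1 = m).card (t m) + if m ∈ I then δ - 1 else 0) := by
    rw [h2]
    refine Finset.sum_le_sum fun m _ => ?_
    have h4 := card_filter_fst_le Z m
    split_ifs with hm
    · omega
    · have : ¬ t m ≤ (Z.filter fun c => c.1 = m).card := fun h => hm (by simp [I, h])
      omega
  rw [Finset.sum_add_distrib, Finset.sum_ite_mem, Finset.univ_inter, Finset.sum_const,
    smul_eq_mul] at h3
  have h5 := Nat.mul_le_mul_right (δ - 1) hI
  omega

/-- A nonzero codeword that vanishes on the `z` smallest blocks and on as many further chosen vectors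
as the dimension permits. -/
theorem exists_card_zeros_ge (ht : ∀ i, t i ≤ r) (B : Fin A → Matrix (Fin r) (Fin (δ - 1)) F)
    (g : (i : Fin A) → Fin (t i) → (Fin k → F)) (hk : 1 ≤ k) (hsum : k ≤ ∑ i, t i) {z : ℕ}
    (hz : IsFullBlockCount k t z) :
    ∃ x : Fin k → F, x ≠ 0 ∧ k - 1 + z * (δ - 1) ≤
      (Finset.univ.filter fun c => (x ᵥ* blockMatrix ht B g) c = 0).card := by
  classical
  obtain ⟨I, hIz, hI⟩ := hz.exists_blocks
  let D₀ : Finset (Σ i, Fin (t i)) := I.sigma fun _ => Finset.univ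
  obtain ⟨D, hD₀, -, hD⟩ := Finset.exists_subsuperset_card_eq (n := k - 1) (Finset.subset_univ D₀)
    (by simpa [D₀] using hI) (by simp; omega)
  let L : (Fin k → F) →ₗ[F] (D → F) := LinearMap.pi fun c => (dotProductBilin F F).flip (g c.1.1 c.1.2)
  have hker : LinearMap.ker L ≠ ⊥ := by
    apply LinearMap.ker_ne_bot_of_finrank_lt
    simp [hD]
    omega
  obtain ⟨x, hxL, hx⟩ := Submodule.exists_mem_ne_zero_of_ne_bot hker
  refine ⟨x, hx, ?_⟩
  have hxD : ∀ c ∈ D, x ⬝ᵥ g c.1 c.2 = 0 := fun c hc => congrFun hxL ⟨c, hc⟩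
  let e₁ : (Σ i, Fin (t i)) ↪ ColIndex t δ :=
    ⟨fun c => ⟨c.1, Sum.inl c.2⟩, by
      rintro ⟨i, l⟩ ⟨i', l'⟩ h
      obtain ⟨rfl, h⟩ := Sigma.mk.inj h
      exact congrArg (Sigma.mk i) (Sum.inl.inj (eq_of_heq h))⟩
  let e₂ : (Σ _ : Fin A, Fin (δ - 1)) ↪ ColIndex t δ :=
    ⟨fun c => ⟨c.1, Sum.inr c.2⟩, by
      rintro ⟨i, l⟩ ⟨i', l'⟩ h
      obtain ⟨rfl, h⟩ := Sigma.mk.inj h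
      exact congrArg (Sigma.mk i) (Sum.inr.inj (eq_of_heq h))⟩
  have hdisj : Disjoint (D.map e₁) ((I.sigma fun _ => Finset.univ).map e₂) := by
    rw [Finset.disjoint_left]
    intro c hc hc'
    obtain ⟨⟨i, l⟩, -, rfl⟩ := Finset.mem_map.1 hc
    obtain ⟨⟨i', l'⟩, -, h⟩ := Finset.mem_map.1 hc'
    obtain ⟨rfl, h⟩ := Sigma.mk.inj h
    exact Sum.inr_ne_inl (eq_of_heq h)
  calc k - 1 + z * (δ - 1) = (D.map e₁ ∪ (I.sigma fun _ => Finset.univ).map e₂).card := by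
        rw [Finset.card_union_of_disjoint hdisj, Finset.card_map, Finset.card_map, hD,
          Finset.card_sigma]
        simp [hIz]
    _ ≤ _ := Finset.card_le_card fun c hc => by
        refine Finset.mem_filter.2 ⟨Finset.mem_univ c, ?_⟩
        change x ⬝ᵥ blockCol ht B g c = 0
        rcases Finset.mem_union.1 hc with hc | hc
        · obtain ⟨c, hcD, rfl⟩ := Finset.mem_map.1 hc
          exact hxD c hcD
        · obtain ⟨⟨i, m⟩, hi, rfl⟩ := Finset.mem_map.1 hc
          have hzero : dotProductBilin F F x (blockCol ht B g (e₂ ⟨i, m⟩)) = 0 := by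
            change dotProductBilin F F x (∑ l : Fin (t i), B i (Fin.castLE (ht i) l) m • g i l) = 0
            rw [map_sum]
            refine Finset.sum_eq_zero fun l _ => ?_
            rw [map_smul]
            have : dotProductBilin F F x (g i l) = 0 :=
              hxD ⟨i, l⟩ (hD₀ (by simpa [D₀] using hi))
            rw [this, smul_zero]
          exact hzero

theorem vecMul_blockMatrix_ne_zero (hB : ∀ i, AllMinorsInvertible (B i)) (hg : IsOutcome ht B g)
    (hsum : k ≤ ∑ i, t i) {x : Fin k → F} (hx : x ≠ 0) : x ᵥ* blockMatrix ht B g ≠ 0 := by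
  classical
  intro h0
  have h1 := sum_min_card_zeros_lt hB hg hx
  refine absurd (hsum.trans (Finset.sum_le_sum fun m _ => le_min ?_ le_rfl)) (not_le.2 h1)
  calc t m = ((Finset.univ : Finset (Fin (t m))).image
        fun l => (⟨m, Sum.inl l⟩ : ColIndex t δ)).card := by
        rw [Finset.card_image_of_injective, Finset.card_univ, Fintype.card_fin]
        intro l l' h
        obtain ⟨-, h⟩ := Sigma.mk.inj h
        exact Sum.inl.inj (eq_of_heq h)
    _ ≤ _ := Finset.card_le_card fun c hc => by
        obtain ⟨l, -, rfl⟩ := Finset.mem_image.1 hc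
        simp [h0]

theorem card_colIndex (t : Fin A → ℕ) (δ : ℕ) :
    Fintype.card (ColIndex t δ) = ∑ i, (t i + (δ - 1)) := by
  simp [ColIndex]

theorem hasMinDist_blockMatrix (hk : 1 ≤ k) (hsum : k ≤ ∑ i, t i)
    (hB : ∀ i, AllMinorsInvertible (B i)) (hg : IsOutcome ht B g)
    {z : ℕ} (hz : IsFullBlockCount k t z) :
    ∃ d, d + (k - 1 + z * (δ - 1)) = ∑ i, (t i + (δ - 1)) ∧
      HasMinDist (rowCode (blockMatrix ht B g) : Set (ColIndex t δ → F)) d ∧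
      ∀ x : Fin k → F, x ≠ 0 → d ≤ hammingNorm (x ᵥ* blockMatrix ht B g) := by
  have hlow : ∀ x : Fin k → F, x ≠ 0 → ∑ i, (t i + (δ - 1)) ≤
      hammingNorm (x ᵥ* blockMatrix ht B g) + (k - 1 + z * (δ - 1)) := by
    intro x hx
    rw [← card_colIndex, ← hammingNorm_add_card_zeros (x ᵥ* blockMatrix ht B g)]
    have := card_zeros_le hB hg hz hx
    omega
  obtain ⟨x, hx, hxz⟩ := exists_card_zeros_ge ht B g hk hsum hz
  have h1 := hammingNorm_add_card_zeros (x ᵥ* blockMatrix ht B g)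
  have h2 := hlow x hx
  rw [card_colIndex] at h1
  refine ⟨hammingNorm (x ᵥ* blockMatrix ht B g), by omega,
    hasMinDist_of_hammingNorm ⟨_, mem_rowCode.2 ⟨x, rfl⟩,
      vecMul_blockMatrix_ne_zero hB hg hsum hx, rfl⟩ ?_, ?_⟩
  · intro w hw hw0
    obtain ⟨y, rfl⟩ := mem_rowCode.1 hw
    have := hlow y (by rintro rfl; exact hw0 (Matrix.zero_vecMul _))
    omega
  · intro y hy
    have := hlow y hy
    omega

theorem isLinearLRC_blockMatrix (hr : 1 ≤ r) (hrk : r ≤ k) (hδ : 2 ≤ δ) (ht1 : ∀ i, 1 ≤ t i)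
    (hsum : k ≤ ∑ i, t i) (hB : ∀ i, AllMinorsInvertible (B i)) (hg : IsOutcome ht B g) {n d : ℕ}
    (hn : ∑ i, (t i + (δ - 1)) = n)
    (hd : HasMinDist (rowCode (blockMatrix ht B g) : Set (ColIndex t δ → F)) d) :
    IsLinearLRC (rowCode (blockMatrix ht B g)) n k d r δ where
  one_le_r := hr
  r_le_k := hrk
  two_le_δ := hδ
  length_eq := by rw [card_colIndex, hn]
  finrank_eq := finrank_rowCode fun x hx => by
    by_contra h
    exact vecMul_blockMatrix_ne_zero hB hg hsum h hx
  minDist := hd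
  locality := by
    rintro ⟨i, e⟩
    let φ : Fin (t i) ⊕ Fin (δ - 1) ↪ ColIndex t δ :=
      Function.Embedding.sigmaMk (β := fun i => Fin (t i) ⊕ Fin (δ - 1)) i
    refine ⟨Finset.univ.map φ, Finset.mem_map_of_mem φ (Finset.mem_univ e), ?_,
      hasMinDist_restrictCode_map (by omega) (ht i) (hB i) (g i)
        ⟨⟨0, ht1 i⟩, outcome_ne_zero (hr.trans hrk) hB hg i _⟩ _ φ fun e a =>
        congrFun (blockCol_eq i e) a⟩
    rw [Finset.card_map, Finset.card_univ, Fintype.card_sum, Fintype.card_fin, Fintype.card_fin]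
    have := ht i
    omega

end MinDist

/-! ### The construction never gets stuck -/

section NeverStuck

open Submodule

variable {F : Type*} [Field F]

/-- For `r ≥ 2` there are at most `2 + r (δ - 1) ≤ r δ` entries of `(I_r | B)`, and each step from
`U_m` to `U_{m+1}` at most raises the number of elements to the fourth power. -/
theorem exists_finset_coeffSet_subset {r δ : ℕ} (hr : 2 ≤ r) (hδ : 1 ≤ δ)
    (B : Matrix (Fin r) (Fin (δ - 1)) F) (m : ℕ) :
    ∃ U : Finset F, coeffSet B m ⊆ U ∧ U.card ≤ (r * δ) ^ 4 ^ m := by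
  classical
  induction m with
  | zero =>
    refine ⟨{0, 1} ∪ Finset.univ.image fun p : Fin r × Fin (δ - 1) => B p.1 p.2, ?_, ?_⟩
    · rintro _ ⟨a, c | c, rfl⟩
      · rw [Matrix.fromCols_apply_inl, Matrix.one_apply]
        split_ifs <;> simp
      · rw [Matrix.fromCols_apply_inr]
        exact Finset.mem_coe.2 (Finset.mem_union_right _
          (Finset.mem_image.2 ⟨(a, c), Finset.mem_univ _, rfl⟩))
    · have h1 : ({0, 1} : Finset F).card ≤ 2 := Finset.card_le_two
      have h2 : (Finset.univ.image fun p : Fin r × Fin (δ - 1) => B p.1 p.2).card ≤ r * (δ - 1) :=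
        Finset.card_image_le.trans (by simp)
      have h3 : r * (δ - 1) + r = r * δ := by
        rw [← Nat.mul_succ, Nat.succ_eq_add_one, Nat.sub_add_cancel hδ]
      refine (Finset.card_union_le _ _).trans ?_
      rw [pow_zero, pow_one]
      omega
  | succ m ih =>
    obtain ⟨U, hU, hUc⟩ := ih
    refine ⟨(U ×ˢ U ×ˢ U ×ˢ U).image fun p => p.1 - p.2.1 * p.2.2.1 / p.2.2.2, ?_, ?_⟩
    · rintro _ ⟨x, hx, y, hy, z, hz, w, hw, -, rfl⟩
      refine Finset.mem_coe.2 (Finset.mem_image.2 ⟨(x, y, z, w), ?_, rfl⟩)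
      simp only [Finset.mem_product]
      exact ⟨hU hx, hU hy, hU hz, hU hw⟩
    · refine Finset.card_image_le.trans ?_
      simp only [Finset.card_product]
      calc U.card * (U.card * (U.card * U.card)) = U.card ^ 4 := by ring
        _ ≤ ((r * δ) ^ 4 ^ m) ^ 4 := Nat.pow_le_pow_left hUc 4
        _ = (r * δ) ^ 4 ^ (m + 1) := by rw [← pow_mul, ← pow_succ]

theorem exists_finset_family_cover {V : Type*} (P : Finset V) {N κ : ℕ} (hP : P.card ≤ N)
    (hκ : κ ≤ N) : ∃ 𝒲 : Finset (Finset V), 𝒲.card ≤ N.choose κ ∧ (∀ W ∈ 𝒲, W.card ≤ κ) ∧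
      ∀ Q ⊆ P, Q.card ≤ κ → ∃ W ∈ 𝒲, Q ⊆ W := by
  by_cases h : κ ≤ P.card
  · refine ⟨P.powersetCard κ, ?_, fun W hW => (Finset.mem_powersetCard.1 hW).2.le, ?_⟩
    · rw [Finset.card_powersetCard]
      exact Nat.choose_le_choose κ hP
    · intro Q hQ hQκ
      obtain ⟨W, hQW, hWP, hW⟩ := Finset.exists_subsuperset_card_eq hQ hQκ h
      exact ⟨W, Finset.mem_powersetCard.2 ⟨hWP, hW⟩, hQW⟩
  · refine ⟨{P}, ?_, ?_, ?_⟩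
    · rw [Finset.card_singleton]
      exact Nat.choose_pos hκ
    · intro W hW
      rw [Finset.mem_singleton.1 hW]
      omega
    · exact fun Q hQ _ => ⟨P, Finset.mem_singleton_self P, hQ⟩

/-- The counting step: each of the at most `|E| * (N choose κ)` conditions on `v` excludes at most
`q ^ κ` vectors. -/
theorem exists_forall_smul_add_notMem_span [Fintype F] {V : Type*} [AddCommGroup V] [Module F V]
    [Fintype V] (P : Finset V) {N κ : ℕ} (hP : P.card ≤ N) (hκ : κ ≤ N) (E : Finset (F × V))
    (hE : ∀ e ∈ E, e.1 ≠ 0)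
    (h : E.card * N.choose κ * Fintype.card F ^ κ < Fintype.card V) :
    ∃ v : V, ∀ e ∈ E, ∀ Q ⊆ P, Q.card ≤ κ → e.1 • v + e.2 ∉ span F (Q : Set V) := by
  classical
  obtain ⟨𝒲, h𝒲, h𝒲κ, hcov⟩ := exists_finset_family_cover P hP hκ
  let bad : Finset V := (E ×ˢ 𝒲).biUnion fun p =>
    Finset.univ.filter fun v => p.1.1 • v + p.1.2 ∈ span F (p.2 : Set V)
  have hbad : bad.card < Fintype.card V := by
    refine lt_of_le_of_lt ?_ h
    refine (Finset.card_biUnion_le_card_mul _ _ (Fintype.card F ^ κ) fun p hp => ?_).trans ?_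
    · obtain ⟨hpE, hpW⟩ := Finset.mem_product.1 hp
      let f : V → V := fun v => p.1.1 • v + p.1.2
      have hf : Function.Injective f := fun v v' hv =>
        smul_right_injective V (hE _ hpE) (add_right_cancel hv)
      calc _ ≤ (Finset.univ.filter fun v => v ∈ span F (p.2 : Set V)).card := by
            refine Finset.card_le_card_of_injOn f (fun v hv => ?_) hf.injOn
            exact Finset.mem_coe.2 (Finset.mem_filter.2
              ⟨Finset.mem_univ _, (Finset.mem_filter.1 (Finset.mem_coe.1 hv)).2⟩)
        _ = Fintype.card (span F (p.2 : Set V)) := (Fintype.card_subtype _).symm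
        _ = Fintype.card F ^ Module.finrank F (span F (p.2 : Set V)) :=
            Module.card_eq_pow_finrank
        _ ≤ Fintype.card F ^ κ := Nat.pow_le_pow_right Fintype.card_pos
            ((finrank_span_finset_le_card p.2).trans (h𝒲κ _ hpW))
    · rw [Finset.card_product]
      gcongr
  obtain ⟨v, hv⟩ : ∃ v, v ∉ bad := by
    by_contra hcon
    push Not at hcon
    rw [Finset.eq_univ_iff_forall.2 hcon, Finset.card_univ] at hbad
    exact lt_irrefl _ hbad
  refine ⟨v, fun e he Q hQP hQκ hmem => hv ?_⟩
  obtain ⟨W, hW, hQW⟩ := hcov Q hQP hQκ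
  refine Finset.mem_biUnion.2 ⟨(e, W), Finset.mem_product.2 ⟨he, hW⟩, ?_⟩
  exact Finset.mem_filter.2 ⟨Finset.mem_univ _, span_mono (by exact_mod_cast hQW) hmem⟩

variable {V : Type*} [AddCommGroup V] [Module F V]

theorem exists_finset_combosBelow_subset (U : Finset F) {m : ℕ} (g : Fin m → V) (j : Fin m) :
    ∃ P : Finset V, combosBelow (U : Set F) g j ⊆ P ∧ P.card ≤ U.card ^ (j : ℕ) := by
  classical
  refine ⟨(Finset.univ : Finset (Finset.Iio j → U)).image 
    fun u => ∑ h : Finset.Iio j, (u h : F) • g h, ?_, ?_⟩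
  · rintro _ ⟨u, hu, rfl⟩
    refine Finset.mem_coe.2 (Finset.mem_image.2
      ⟨fun h => ⟨u h, hu h (Finset.mem_Iio.1 h.2)⟩, Finset.mem_univ _, ?_⟩)
    exact Finset.sum_coe_sort (Finset.Iio j) fun h => u h • g h
  · refine Finset.card_image_le.trans ?_
    rw [Finset.card_univ, Fintype.card_fun, Fintype.card_coe, Fintype.card_coe, Fin.card_Iio]

/-- The combinations in `combosUpTo`, recorded as pairs of the coefficient at `j` and the sum of the
other terms. -/
theorem exists_finset_combosUpTo (U : Finset F) {m : ℕ} (g : Fin m → V) (j : Fin m) :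
    ∃ E : Finset (F × V), E.card ≤ U.card ^ ((j : ℕ) + 1) ∧ (∀ e ∈ E, e.1 ≠ 0) ∧
      ∀ u : Fin m → F, (∀ h ≤ j, u h ∈ U) → u j ≠ 0 → (u j, ∑ h ∈ Finset.Iio j, u h • g h) ∈ E := by
  classical
  obtain ⟨P, hP, hPc⟩ := exists_finset_combosBelow_subset U g j
  refine ⟨(U.filter fun a => a ≠ 0) ×ˢ P, ?_, ?_, ?_⟩
  · rw [Finset.card_product, pow_succ, mul_comm]
    exact Nat.mul_le_mul hPc (Finset.card_filter_le _ _)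
  · intro e he
    exact (Finset.mem_filter.1 (Finset.mem_product.1 he).1).2
  · intro u hu huj
    exact Finset.mem_product.2 ⟨Finset.mem_filter.2 ⟨hu j le_rfl, huj⟩,
      hP ⟨u, fun h hh => hu h hh.le, rfl⟩⟩

variable {k r δ A : ℕ} {t : Fin A → ℕ}

theorem blockCol_congr (ht : ∀ i, t i ≤ r) (B : Fin A → Matrix (Fin r) (Fin (δ - 1)) F)
    {g g' : (i : Fin A) → Fin (t i) → (Fin k → F)} {c : ColIndex t δ} (h : g c.1 = g' c.1) :
    blockCol ht B g c = blockCol ht B g' c := by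
  unfold blockCol
  rw [h]

/-- Whether the choice at a position is good depends only on the vectors up to this position. -/
theorem IsGoodChoice.congr {ht : ∀ i, t i ≤ r} {B : Fin A → Matrix (Fin r) (Fin (δ - 1)) F}
    {g g' : (i : Fin A) → Fin (t i) → (Fin k → F)} {i : Fin A} {j : Fin (t i)}
    (hg : IsGoodChoice ht B g i j) (h₁ : ∀ m < i, g m = g' m) (h₂ : ∀ l ≤ j, g i l = g' i l) :
    IsGoodChoice ht B g' i j := by
  have hcol : ∀ J : Finset (ColIndex t δ), IsEarlierSelection i J →
      blockCol ht B g '' (J : Set (ColIndex t δ)) = blockCol ht B g' '' (J : Set (ColIndex t δ)) :=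
    fun J hJ => Set.image_congr fun c hc => blockCol_congr ht B (h₁ _ (hJ.1 c hc))
  unfold IsGoodChoice at hg ⊢
  split_ifs at hg ⊢ with hi hj
  · exact hg.congr fun l hl => h₂ l hl
  · intro J hJ hJk
    rw [← hcol J hJ, ← h₂ j le_rfl]
    exact hg J hJ hJk
  · intro J K hJ hK hKj hJK x hx
    rw [← hcol J hJ]
    refine hg J K hJ (fun y hy => ?_) hKj hJK x ?_
    · obtain ⟨u, hu, rfl⟩ := hK hy
      refine ⟨u, hu, Finset.sum_congr rfl fun l hl => ?_⟩
      rw [h₂ l (Finset.mem_Iio.1 hl).le]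
    · obtain ⟨u, hu, huj, rfl⟩ := hx
      refine ⟨u, hu, huj, Finset.sum_congr rfl fun l hl => ?_⟩
      rw [h₂ l (Finset.mem_Iic.1 hl)]

theorem exists_isGoodChoice_first_block {ht : ∀ i, t i ≤ r}
    {B : Fin A → Matrix (Fin r) (Fin (δ - 1)) F} (hrk : r ≤ k)
    (g : (i : Fin A) → Fin (t i) → (Fin k → F)) {i : Fin A} (hi : (i : ℕ) = 0) (j : Fin (t i))
    (hg : ∀ l < j, IsGoodChoice ht B g i l) :
    ∃ v, IsGoodChoice ht B (Function.update g i (Function.update (g i) j v)) i j := by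
  have hli : LinearIndepOn F (g i) (Set.Iio j) := by
    by_cases hj : (j : ℕ) = 0
    · have : Set.Iio j = ∅ := Set.eq_empty_of_forall_notMem fun l hl => by
        have := Fin.lt_def.1 (Set.mem_Iio.1 hl)
        omega
      rw [this]
      exact linearIndepOn_empty _ _
    · let l : Fin (t i) := ⟨j - 1, by have := j.2; omega⟩
      have h1 := hg l (Fin.lt_def.2 (by change (j : ℕ) - 1 < j; omega))
      unfold IsGoodChoice at h1
      rw [if_pos hi] at h1
      refine h1.mono fun m hm => Fin.le_def.2 ?_
      have := Fin.lt_def.1 (Set.mem_Iio.1 hm)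
      change (m : ℕ) ≤ j - 1
      omega
  obtain ⟨v, hv⟩ : ∃ v, v ∉ span F (g i '' Set.Iio j) := by
    by_contra hcon
    push Not at hcon
    have htop : span F (g i '' Set.Iio j) = ⊤ := eq_top_iff'.2 hcon
    classical
    have h1 := finrank_span_finset_le_card (R := F) ((Finset.Iio j).image (g i))
    rw [Finset.coe_image, Finset.coe_Iio] at h1
    have h2 : ((Finset.Iio j).image (g i)).card ≤ j := Finset.card_image_le.trans (by simp)
    have h3 := h1.trans h2
    unfold Set.finrank at h3
    rw [htop, finrank_top, Module.finrank_fin_fun] at h3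
    have := j.2
    have := ht i
    omega
  refine ⟨v, ?_⟩
  unfold IsGoodChoice
  rw [if_pos hi, Function.update_self, ← Set.Iio_insert]
  have heq : Set.EqOn (g i) (Function.update (g i) j v) (Set.Iio j) := fun l hl =>
    (Function.update_of_ne (ne_of_lt hl) _ _).symm
  refine (hli.congr heq).insert ?_
  rwa [Function.update_self, ← heq.image_eq]

/-- A good choice in a later block exists as soon as the field is large enough, whatever the earlier
choices are. -/
theorem exists_isGoodChoice_later_block [Fintype F] {n : ℕ} (hr : 1 ≤ r) (hδ : 1 ≤ δ) (hk : 1 ≤ k)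
    (hkn : k ≤ n) (hn : ∑ i, (t i + (δ - 1)) ≤ n)
    (hq : (r * δ) ^ (r * 4 ^ r) * (n + (r * δ) ^ ((r - 1) * 4 ^ r)).choose (k - 1)
      < Fintype.card F)
    (ht : ∀ i, t i ≤ r) (B : Fin A → Matrix (Fin r) (Fin (δ - 1)) F)
    (g : (i : Fin A) → Fin (t i) → (Fin k → F)) {i : Fin A} (hi : (i : ℕ) ≠ 0) (j : Fin (t i)) :
    ∃ v, IsGoodChoice ht B (Function.update g i (Function.update (g i) j v)) i j := by
  classical
  have hrδ : 1 ≤ r * δ := Nat.mul_pos hr hδ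
  -- the size condition in the form needed for the counting step
  have hcount : ∀ E : Finset (F × (Fin k → F)), E.card ≤ (r * δ) ^ (r * 4 ^ r) →
      E.card * (n + (r * δ) ^ ((r - 1) * 4 ^ r)).choose (k - 1) * Fintype.card F ^ (k - 1) <
        Fintype.card (Fin k → F) := by
    intro E hE
    have h1 : Fintype.card (Fin k → F) = Fintype.card F * Fintype.card F ^ (k - 1) := by
      rw [Fintype.card_fun, Fintype.card_fin, ← pow_succ', Nat.sub_add_cancel hk]
    rw [h1]
    exact Nat.mul_lt_mul_of_pos_right ((Nat.mul_le_mul_right _ hE).trans_lt hq)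
      (pow_pos Fintype.card_pos _)
  let Q : Finset (Fin k → F) := Finset.univ.image (blockCol ht B g)
  have hQ : Q.card ≤ n := by
    refine Finset.card_image_le.trans ?_
    rw [Finset.card_univ, card_colIndex]
    exact hn
  have hcol : ∀ (v : Fin k → F) (J : Finset (ColIndex t δ)), IsEarlierSelection i J →
      blockCol ht B (Function.update g i (Function.update (g i) j v)) '' (J : Set (ColIndex t δ)) =
        (J.image (blockCol ht B g) : Finset (Fin k → F)) := by
    intro v J hJ
    rw [Finset.coe_image]
    exact Set.image_congr fun c hc => blockCol_congr ht B
      (Function.update_of_ne (ne_of_lt (hJ.1 c hc)) _ _)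
  unfold IsGoodChoice
  simp only [if_neg hi, Function.update_self]
  by_cases hj : (j : ℕ) = 0
  · simp only [if_pos hj]
    obtain ⟨v, hv⟩ := exists_forall_smul_add_notMem_span Q
      (N := n + (r * δ) ^ ((r - 1) * 4 ^ r)) (κ := k - 1) (by omega) (by omega)
      {((1 : F), (0 : Fin k → F))} (by simp)
      (hcount _ (by rw [Finset.card_singleton]; exact Nat.one_le_pow _ _ hrδ))
    refine ⟨v, fun J hJ hJk => ?_⟩
    rw [hcol v J hJ]
    have h1 := hv _ (Finset.mem_singleton_self _) (J.image (blockCol ht B g))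
      (Finset.image_subset_image (Finset.subset_univ J)) (Finset.card_image_le.trans hJk)
    simpa using h1
  · simp only [if_neg hj]
    have hjr : (j : ℕ) + 1 ≤ r := j.2.trans_le (ht i)
    obtain ⟨U, hU, hUc⟩ := exists_finset_coeffSet_subset (by omega) hδ (B i) r
    have hUpow : ∀ e e' : ℕ, e ≤ e' → U.card ^ e ≤ (r * δ) ^ (e' * 4 ^ r) := by
      intro e e' he
      calc U.card ^ e ≤ ((r * δ) ^ 4 ^ r) ^ e := Nat.pow_le_pow_left hUc e
        _ ≤ ((r * δ) ^ 4 ^ r) ^ e' := Nat.pow_le_pow_right (Nat.one_le_pow _ _ hrδ) he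
        _ = (r * δ) ^ (e' * 4 ^ r) := by rw [← pow_mul, mul_comm e']
    obtain ⟨P, hP, hPc⟩ := exists_finset_combosBelow_subset U (g i) j
    obtain ⟨E, hEc, hE0, hE⟩ := exists_finset_combosUpTo U (g i) j
    have hPpow := hPc.trans (hUpow j (r - 1) (by omega))
    obtain ⟨v, hv⟩ := exists_forall_smul_add_notMem_span (Q ∪ P)
      (N := n + (r * δ) ^ ((r - 1) * 4 ^ r)) (κ := k - 1)
      ((Finset.card_union_le _ _).trans (by omega)) (by omega) E hE0
      (hcount E (hEc.trans (hUpow _ r hjr)))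
    refine ⟨v, fun J K hJ hK hKj hJK x hx => ?_⟩
    have hsame : ∀ u : Fin (t i) → F,
        ∑ h ∈ Finset.Iio j, u h • Function.update (g i) j v h = ∑ h ∈ Finset.Iio j, u h • g i h :=
      fun u => Finset.sum_congr rfl fun h hh => by
        rw [Function.update_of_ne (Finset.mem_Iio.1 hh).ne]
    obtain ⟨u, hu, huj, rfl⟩ := hx
    rw [hcol v J hJ, ← Finset.coe_union, ← Finset.Iio_insert,
      Finset.sum_insert (by simp), Function.update_self, hsame]
    refine hv _ (hE u (fun h hh => hU (hu h hh)) huj) _ (Finset.union_subset_union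
      (Finset.image_subset_image (Finset.subset_univ J)) fun y hy => ?_)
      ((Finset.card_union_le _ _).trans ?_)
    · obtain ⟨u', hu', rfl⟩ := hK (Finset.mem_coe.2 hy)
      rw [hsame]
      exact hP ⟨u', fun h hh => hU (hu' h hh), rfl⟩
    · have : (J.image (blockCol ht B g)).card ≤ J.card := Finset.card_image_le
      omega

theorem neverStuck_of_card_lt [Fintype F] {n : ℕ} (hr : 1 ≤ r) (hrk : r ≤ k) (hδ : 1 ≤ δ)
    (hkn : k ≤ n) (hn : ∑ i, (t i + (δ - 1)) ≤ n)
    (hq : (r * δ) ^ (r * 4 ^ r) * (n + (r * δ) ^ ((r - 1) * 4 ^ r)).choose (k - 1)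
      < Fintype.card F)
    (ht : ∀ i, t i ≤ r) (B : Fin A → Matrix (Fin r) (Fin (δ - 1)) F) : NeverStuck k ht B := by
  intro i j g hg
  by_cases hi : (i : ℕ) = 0
  · exact exists_isGoodChoice_first_block hrk g hi j fun l hl => hg i l (Or.inr ⟨rfl, hl⟩)
  · exact exists_isGoodChoice_later_block hr hδ (hr.trans hrk) hkn hn hq ht B g hi j

theorem NeverStuck.exists_isOutcome {ht : ∀ i, t i ≤ r}
    {B : Fin A → Matrix (Fin r) (Fin (δ - 1)) F} (h : NeverStuck k ht B) :
    ∃ g : (i : Fin A) → Fin (t i) → (Fin k → F), IsOutcome ht B g := by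
  -- positions are processed in the order of `i * r + j`, which is injective since `j < t i ≤ r`
  have hlt : ∀ (i i' : Fin A) (j : Fin (t i)) (j' : Fin (t i')), i' < i →
      (i' : ℕ) * r + j' < i * r + j := by
    intro i i' j j' hii
    have h1 : ((i' : ℕ) + 1) * r ≤ i * r := Nat.mul_le_mul_right r (Fin.lt_def.1 hii)
    have h2 := j'.2.trans_le (ht i')
    rw [Nat.add_mul, one_mul] at h1
    omega
  suffices hN : ∀ N : ℕ, ∃ g : (i : Fin A) → Fin (t i) → (Fin k → F),
      ∀ (i : Fin A) (j : Fin (t i)), (i : ℕ) * r + j < N → IsGoodChoice ht B g i j by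
    obtain ⟨g, hg⟩ := hN (A * r)
    refine ⟨g, fun i j => hg i j ?_⟩
    have h1 : ((i : ℕ) + 1) * r ≤ A * r := Nat.mul_le_mul_right r i.2
    have h2 := j.2.trans_le (ht i)
    rw [Nat.add_mul, one_mul] at h1
    omega
  intro N
  induction N with
  | zero => exact ⟨fun _ _ => 0, fun _ _ h => absurd h (Nat.not_lt_zero _)⟩
  | succ N ih =>
    obtain ⟨g, hg⟩ := ih
    by_cases hex : ∃ (i : Fin A) (j : Fin (t i)), (i : ℕ) * r + j = N
    · obtain ⟨i, j, hij⟩ := hex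
      obtain ⟨v, hv⟩ := h i j g fun i' j' hij' => hg i' j' (by
        rcases hij' with hlt' | ⟨rfl, hj⟩
        · exact hij ▸ hlt i i' j j' hlt'
        · omega)
      refine ⟨Function.update g i (Function.update (g i) j v), fun i' j' hN' => ?_⟩
      rcases lt_trichotomy i' i with hii | rfl | hii
      · refine (hg i' j' (hij ▸ hlt i i' j j' hii)).congr (fun m hm => ?_) fun l _ => ?_
        · exact (Function.update_of_ne (hm.trans hii).ne _ _).symm
        · rw [Function.update_of_ne hii.ne]
      · rcases lt_trichotomy j' j with hjj | rfl | hjj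
        · refine (hg i' j' (by rw [Fin.lt_def] at hjj; omega)).congr (fun m hm => ?_) fun l hl => ?_
          · exact (Function.update_of_ne hm.ne _ _).symm
          · rw [Function.update_self, Function.update_of_ne (hl.trans_lt hjj).ne]
        · exact hv
        · rw [Fin.lt_def] at hjj
          omega
      · have := hlt i' i j' j hii
        omega
    · refine ⟨g, fun i j hij => hg i j ?_⟩
      have : (i : ℕ) * r + j ≠ N := fun h => hex ⟨i, j, h⟩
      omega

end NeverStuck

/-! ### Optimality -/

section Optimality

theorem IsFullBlockCount.mul_le {k r A : ℕ} {t : Fin A → ℕ} (ht : ∀ i, t i ≤ r) {z : ℕ}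
    (hz : IsFullBlockCount k t z) : z * r ≤ k - 1 + ∑ i, (r - t i) := by
  obtain ⟨I, hIz, hI⟩ := hz.exists_blocks
  have h1 : ∑ i ∈ I, (t i + (r - t i)) = z * r := by
    rw [Finset.sum_congr rfl fun i _ => Nat.add_sub_cancel' (ht i), Finset.sum_const, hIz,
      smul_eq_mul]
  have h2 : ∑ i ∈ I, (r - t i) ≤ ∑ i, (r - t i) :=
    Finset.sum_le_sum_of_subset (Finset.subset_univ I)
  rw [Finset.sum_add_distrib] at h1
  omega

theorem IsFullBlockCount.lt_mul {k r A : ℕ} {t : Fin A → ℕ} (ht : ∀ i, t i ≤ r) {z : ℕ}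
    (hz : IsFullBlockCount k t z) : k - 1 < (z + 1) * r := by
  refine hz.2.trans_le ((Finset.sum_le_card_nsmul _ _ r fun i _ => ht _).trans ?_)
  rw [smul_eq_mul]
  refine Nat.mul_le_mul_right r ?_
  rw [← Finset.card_map Fin.valEmbedding]
  refine (Finset.card_le_card (t := Finset.range (z + 1)) fun m hm => ?_).trans_eq
    (Finset.card_range _)
  obtain ⟨i, hi, rfl⟩ := Finset.mem_map.1 hm
  exact Finset.mem_range.2 (Finset.mem_filter.1 hi).2

theorem le_ceil_div {k r z : ℕ} (hr : 1 ≤ r) (h : z * r < k + r) : (z : ℤ) ≤ ⌈(k : ℚ) / r⌉ := by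
  have hr' : (0 : ℚ) < r := by exact_mod_cast hr
  have h1 : (((z : ℤ) - 1 : ℤ) : ℚ) < (k : ℚ) / r := by
    rw [lt_div_iff₀ hr']
    have : (z : ℚ) * r < k + r := by exact_mod_cast h
    push_cast
    linarith
  have := Int.lt_ceil.2 h1
  omega

theorem ceil_div_le {k r z : ℕ} (hr : 1 ≤ r) (h : k ≤ z * r) : ⌈(k : ℚ) / r⌉ ≤ (z : ℤ) := by
  have hr' : (0 : ℚ) < r := by exact_mod_cast hr
  rw [Int.ceil_le, div_le_iff₀ hr']
  exact_mod_cast h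

/-- The minimum distance of the construction compared with `dOpt`, in terms of the deficiency
`∑ (r - t_i)`. -/
theorem dOpt_of_isFullBlockCount {k r δ A n d z : ℕ} {t : Fin A → ℕ} (hr : 1 ≤ r) (hk : 1 ≤ k)
    (hδ : 1 ≤ δ) (ht : ∀ i, t i ≤ r) (hz : IsFullBlockCount k t z)
    (hd : d + (k - 1 + z * (δ - 1)) = n) :
    (∑ i, (r - t i) < r → dOpt n k r δ - δ + 1 ≤ d) ∧
      (∑ i, (r - t i) = 0 → (d : ℤ) = dOpt n k r δ) := by
  have hdZ : (d : ℤ) = n - k + 1 - z * ((δ : ℤ) - 1) := by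
    have h : (d : ℤ) + (((k - 1 : ℕ) : ℤ) + z * ((δ - 1 : ℕ) : ℤ)) = n := by exact_mod_cast hd
    rw [Nat.cast_sub hk, Nat.cast_sub hδ] at h
    push_cast at h
    linarith
  have h1 := hz.mul_le ht
  have h2 := hz.lt_mul ht
  constructor
  · intro hdef
    have h3 := le_ceil_div (k := k) (z := z) hr (by omega)
    have h4 : (0 : ℤ) ≤ (⌈(k : ℚ) / r⌉ - z) * ((δ : ℤ) - 1) :=
      mul_nonneg (by omega) (by omega)
    rw [dOpt, hdZ]
    linarith
  · intro hdef
    have h3 : ((z + 1 : ℕ) : ℤ) ≤ ⌈(k : ℚ) / r⌉ :=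
      le_ceil_div hr (by rw [Nat.add_mul, one_mul]; omega)
    have h4 : ⌈(k : ℚ) / r⌉ ≤ ((z + 1 : ℕ) : ℤ) := ceil_div_le hr (by omega)
    rw [dOpt, hdZ, le_antisymm h4 h3]
    push_cast
    ring

theorem le_numBlocks_mul {n r δ : ℕ} (hs : 1 ≤ r + δ - 1) :
    n ≤ numBlocks n r δ * (r + δ - 1) ∧ numBlocks n r δ * (r + δ - 1) < n + (r + δ - 1) := by
  have hs' : (0 : ℚ) < ((r + δ - 1 : ℕ) : ℚ) := by exact_mod_cast hs
  constructor
  · have h1 := Nat.le_ceil ((n : ℚ) / ((r + δ - 1 : ℕ) : ℚ))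
    rw [div_le_iff₀ hs'] at h1
    exact_mod_cast h1
  · have h1 := Nat.ceil_lt_add_one (div_nonneg (Nat.cast_nonneg n) hs'.le)
    rw [div_add_one hs'.ne', lt_div_iff₀ hs'] at h1
    exact_mod_cast h1

/-- The length condition says that the last of the standard blocks has at least `δ` columns. -/
theorem numBlocks_mul_sub_lt {n r δ : ℕ} (hr : 1 ≤ r) (hδ : 1 ≤ δ) (hn : 1 ≤ n)
    (hmod : ∀ m : ℕ, 1 ≤ m → m ≤ δ - 1 → ¬ n ≡ m [MOD r + δ - 1]) :
    numBlocks n r δ * (r + δ - 1) - n < r := by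
  obtain ⟨h1, h2⟩ := le_numBlocks_mul (n := n) (r := r) (δ := δ) (by omega)
  by_contra hcon
  obtain ⟨a, ha⟩ : ∃ a, numBlocks n r δ = a + 1 :=
    Nat.exists_eq_succ_of_ne_zero fun h0 => by rw [h0] at h1; omega
  rw [ha, Nat.add_mul, one_mul] at h1 h2 hcon
  refine hmod (n - a * (r + δ - 1)) (by omega) (by omega) ?_
  have h3 : n = (n - a * (r + δ - 1)) + a * (r + δ - 1) := by omega
  conv_lhs => rw [h3]
  unfold Nat.ModEq
  exact Nat.add_mul_mod_self_right _ _ _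

theorem one_le_stdDims {n r δ : ℕ} (hr : 1 ≤ r)
    (hb : numBlocks n r δ * (r + δ - 1) - n < r) (i : Fin (numBlocks n r δ)) :
    1 ≤ stdDims n r δ i := by
  unfold stdDims
  split_ifs <;> omega

theorem sum_stdDims {n r δ : ℕ} (hr : 1 ≤ r) (hδ : 1 ≤ δ) (hn : 1 ≤ n)
    (hb : numBlocks n r δ * (r + δ - 1) - n < r) :
    ∑ i, (stdDims n r δ i + (δ - 1)) = n ∧
      ∑ i, (r - stdDims n r δ i) = numBlocks n r δ * (r + δ - 1) - n := by
  obtain ⟨h1, -⟩ := le_numBlocks_mul (n := n) (r := r) (δ := δ) (by omega)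
  obtain ⟨a, ha⟩ : ∃ a, numBlocks n r δ = a + 1 :=
    Nat.exists_eq_succ_of_ne_zero fun h0 => by rw [h0] at h1; omega
  have hlast : ∑ i, (r - stdDims n r δ i) = numBlocks n r δ * (r + δ - 1) - n := by
    unfold stdDims
    rw [Fin.sum_univ_eq_sum_range (fun i => r - if i + 1 < numBlocks n r δ then r
      else r - (numBlocks n r δ * (r + δ - 1) - n)) (numBlocks n r δ), ha, Finset.sum_range_succ,
      Finset.sum_eq_zero, if_neg (by omega), ← ha]
    · omega
    · intro i hi
      rw [if_pos (by have := Finset.mem_range.1 hi; omega), Nat.sub_self]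
  refine ⟨?_, hlast⟩
  have h2 : ∑ i, (stdDims n r δ i + (δ - 1)) + ∑ i, (r - stdDims n r δ i) =
      numBlocks n r δ * (r + δ - 1) := by
    rw [← Finset.sum_add_distrib, Finset.sum_congr rfl fun i _ =>
      (show stdDims n r δ i + (δ - 1) + (r - stdDims n r δ i) = r + δ - 1 by
        have := stdDims_le n r δ i
        omega)]
    simp
  omega

end Optimality

/-! ### Repeated columns -/

section Copies

variable {F : Type*} [Field F] [DecidableEq F]

theorem hammingNorm_vecMul_le_appendCopies {ι : Type*} [Fintype ι] {k b : ℕ}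
    (G : Matrix (Fin k) ι F) (c : Fin b → ι) (x : Fin k → F) :
    hammingNorm (x ᵥ* G) ≤ hammingNorm (x ᵥ* appendCopies G c) :=
  Finset.card_le_card_of_injOn Sum.inl
    (fun _ he => Finset.mem_coe.2 (Finset.mem_filter.2
      ⟨Finset.mem_univ _, (Finset.mem_filter.1 (Finset.mem_coe.1 he)).2⟩))
    Sum.inl_injective.injOn

theorem isLinearLRC_appendCopies {k r δ A : ℕ} {t : Fin A → ℕ} {ht : ∀ i, t i ≤ r}
    {B : Fin A → Matrix (Fin r) (Fin (δ - 1)) F} {g : (i : Fin A) → Fin (t i) → (Fin k → F)}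
    (hr : 1 ≤ r) (hrk : r ≤ k) (hδ : 2 ≤ δ) (ht1 : ∀ i, 1 ≤ t i)
    (hB : ∀ i, AllMinorsInvertible (B i)) (hg : IsOutcome ht B g) {n b d : ℕ}
    (hn : ∑ i, (t i + (δ - 1)) + b = n) (c : Fin b → ColIndex t δ) (hd1 : 1 ≤ d)
    (hd : ∀ x : Fin k → F, x ≠ 0 → d ≤ hammingNorm (x ᵥ* blockMatrix ht B g)) :
    ∃ e, d ≤ e ∧ IsLinearLRC (rowCode (appendCopies (blockMatrix ht B g) c)) n k e r δ := by
  classical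
  set G := appendCopies (blockMatrix ht B g) c
  have hlow : ∀ x : Fin k → F, x ≠ 0 → d ≤ hammingNorm (x ᵥ* G) := fun x hx =>
    (hd x hx).trans (hammingNorm_vecMul_le_appendCopies _ c x)
  have hinj : ∀ x : Fin k → F, x ᵥ* G = 0 → x = 0 := by
    intro x hx
    by_contra h0
    have := hlow x h0
    rw [hx, hammingNorm_zero] at this
    omega
  obtain ⟨e, hde, he⟩ := exists_hasMinDist_of_le_hammingNorm (C := rowCode G) (d := d) (by
      let x : Fin k → F := Pi.single ⟨0, hr.trans hrk⟩ 1
      exact ⟨_, mem_rowCode.2 ⟨x, rfl⟩, fun h => (Pi.single_ne_zero_iff.2 one_ne_zero) (hinj x h)⟩)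
    (by
      intro w hw hw0
      obtain ⟨x, rfl⟩ := mem_rowCode.1 hw
      exact hlow x (by rintro rfl; exact hw0 (Matrix.zero_vecMul _)))
  refine ⟨e, hde, hr, hrk, hδ, ?_, finrank_rowCode hinj, he, ?_⟩
  · rw [Fintype.card_sum, card_colIndex, Fintype.card_fin, hn]
  · have hloc : ∀ (i : Fin A) (φ : Fin (t i) ⊕ Fin (δ - 1) ↪ ColIndex t δ ⊕ Fin b),
        (∀ e a, G a (φ e) = blockCol ht B g ⟨i, e⟩ a) → ∀ j ∈ Finset.univ.map φ,
        ∃ S : Finset (ColIndex t δ ⊕ Fin b), j ∈ S ∧ S.card ≤ r + δ - 1 ∧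
          ∃ e : ℕ, δ ≤ e ∧ HasMinDist (restrictCode (rowCode G : Set (_ → F)) S) e := by
      intro i φ hφ j hj
      refine ⟨Finset.univ.map φ, hj, ?_, hasMinDist_restrictCode_map (by omega) (ht i) (hB i) (g i)
        ⟨⟨0, ht1 i⟩, outcome_ne_zero (hr.trans hrk) hB hg i _⟩ _ φ fun e a => ?_⟩
      · rw [Finset.card_map, Finset.card_univ, Fintype.card_sum, Fintype.card_fin, Fintype.card_fin]
        have := ht i
        omega
      · rw [hφ, blockCol_eq]
    have hinr : ∀ m a, G a (Sum.inr m) = blockCol ht B g (c m) a := fun _ _ => rfl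
    rintro (⟨i, e₀⟩ | m)
    · refine hloc i ⟨fun e => Sum.inl ⟨i, e⟩, fun e e' h => ?_⟩ (fun e a => rfl) _
        (Finset.mem_map.2 ⟨e₀, Finset.mem_univ _, rfl⟩)
      exact sigma_mk_injective (β := fun i => Fin (t i) ⊕ Fin (δ - 1)) (Sum.inl.inj h)
    · -- the block of the original of column `m`, with the original replaced by the copy
      obtain ⟨⟨i, e₀⟩, hc⟩ : ∃ y, c m = y := ⟨_, rfl⟩
      refine hloc i ⟨fun e => if e = e₀ then Sum.inr m else Sum.inl ⟨i, e⟩, fun e e' h => ?_⟩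
        (fun e a => ?_) _ (Finset.mem_map.2 ⟨e₀, Finset.mem_univ _, if_pos rfl⟩)
      · dsimp only at h
        split_ifs at h with h1 h2 h2
        · rw [h1, h2]
        · exact sigma_mk_injective (β := fun i => Fin (t i) ⊕ Fin (δ - 1)) (Sum.inl.inj h)
      · change G a (if e = e₀ then Sum.inr m else Sum.inl ⟨i, e⟩) = _
        split_ifs with h1
        · rw [hinr, hc, h1]
        · rfl

end Copies

/-! ### Parameters of the constructed codes -/

theorem mainTheorem5 {F : Type*} [Field F] [Fintype F] [DecidableEq F] (n k r δ : ℕ)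
    (hr : 1 ≤ r) (hrk : r ≤ k) (hδ : 2 ≤ δ)
    (hq : (r * δ) ^ (r * 4 ^ r) * (n + (r * δ) ^ ((r - 1) * 4 ^ r)).choose (k - 1)
      < Fintype.card F) :
    -- arbitrary block sizes `s_i = t_i + δ - 1` between `δ` and `r + δ - 1`
    (∀ (A : ℕ) (t : Fin A → ℕ) (_ : ∀ i, 1 ≤ t i) (ht : ∀ i, t i ≤ r),
      ∑ i, (t i + (δ - 1)) = n → k + A * (δ - 1) ≤ n →
      (∃ B : Matrix (Fin r) (Fin (δ - 1)) F, AllMinorsInvertible B) ∧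
      ∀ B : Fin A → Matrix (Fin r) (Fin (δ - 1)) F, (∀ i, AllMinorsInvertible (B i)) →
        NeverStuck k ht B ∧
        (∃ g : (i : Fin A) → Fin (t i) → (Fin k → F), IsOutcome ht B g) ∧
        (∃! z : ℕ, IsFullBlockCount k t z) ∧
        ∀ g : (i : Fin A) → Fin (t i) → (Fin k → F), IsOutcome ht B g →
          ∀ z : ℕ, IsFullBlockCount k t z →
            ∃ d : ℕ, (d : ℤ) = (n : ℤ) - ((k : ℤ) - 1) - (z : ℤ) * ((δ : ℤ) - 1) ∧
              IsLinearLRC (rowCode (blockMatrix ht B g)) n k d r δ) ∧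
    -- the standard block sizes: optimal if `r + δ - 1` divides `n`, and always almost optimal
    ((∀ m : ℕ, 1 ≤ m → m ≤ δ - 1 → ¬ n ≡ m [MOD r + δ - 1]) →
      k + numBlocks n r δ * (δ - 1) ≤ n →
      (∀ i, 1 ≤ stdDims n r δ i) ∧ ∑ i, (stdDims n r δ i + (δ - 1)) = n ∧
      ∀ B : Fin (numBlocks n r δ) → Matrix (Fin r) (Fin (δ - 1)) F,
        (∀ i, AllMinorsInvertible (B i)) →
        ∀ g : (i : Fin (numBlocks n r δ)) → Fin (stdDims n r δ i) → (Fin k → F),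
          IsOutcome (stdDims_le n r δ) B g →
          ∃ d : ℕ, IsLinearLRC (rowCode (blockMatrix (stdDims_le n r δ) B g)) n k d r δ ∧
            ((r + δ - 1) ∣ n → (d : ℤ) = dOpt n k r δ) ∧
            dOpt n k r δ - (δ : ℤ) + 1 ≤ (d : ℤ)) ∧
    -- the remaining lengths: the optimal code of length `n - b` with `b` repeated columns
    (∀ a b : ℕ, n = a * (r + δ - 1) + b → 1 ≤ b → b ≤ δ - 1 → k ≤ a * r →
      (∃ B : Matrix (Fin r) (Fin (δ - 1)) F, AllMinorsInvertible B) ∧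
      ∀ B : Fin a → Matrix (Fin r) (Fin (δ - 1)) F, (∀ i, AllMinorsInvertible (B i)) →
        NeverStuck (t := fun _ : Fin a => r) k (fun _ => le_rfl) B ∧
        (∃ g : Fin a → Fin r → (Fin k → F),
          IsOutcome (t := fun _ : Fin a => r) (fun _ => le_rfl) B g) ∧
        ∀ g : Fin a → Fin r → (Fin k → F),
          IsOutcome (t := fun _ : Fin a => r) (fun _ => le_rfl) B g →
          ∀ c : Fin b → ColIndex (fun _ : Fin a => r) δ,
            ∃ d : ℕ,
              IsLinearLRC (rowCode (appendCopies
                (blockMatrix (t := fun _ : Fin a => r) (fun _ => le_rfl) B g) c)) n k d r δ ∧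
              dOpt (n - b) k r δ ≤ (d : ℤ) ∧ dOpt n k r δ - (δ : ℤ) + 1 ≤ (d : ℤ)) := by
  have hk : 1 ≤ k := hr.trans hrk
  have hδ1 : 1 ≤ δ := one_le_two.trans hδ
  have hexB : k ≤ n → ∃ B : Matrix (Fin r) (Fin (δ - 1)) F, AllMinorsInvertible B := by
    intro hkn
    -- a Cauchy matrix needs `r + δ - 1 ≤ r δ ≤ (r δ) ^ (r 4 ^ r) < q` field elements
    refine exists_allMinorsInvertible ?_
    have h3 : 1 ≤ (n + (r * δ) ^ ((r - 1) * 4 ^ r)).choose (k - 1) := Nat.choose_pos (by omega)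
    have h4 : r * δ ≤ (r * δ) ^ (r * 4 ^ r) :=
      Nat.le_self_pow (Nat.mul_pos hr (by positivity)).ne' _
    have h5 := Nat.mul_le_mul h4 h3
    have h6 : r + (δ - 1) ≤ r * δ := by
      obtain ⟨r, rfl⟩ := Nat.exists_eq_add_of_le' hr
      obtain ⟨δ, rfl⟩ := Nat.exists_eq_add_of_le' hδ1
      rw [Nat.add_sub_cancel]
      nlinarith [Nat.zero_le (r * δ)]
    omega
  have hdim : ∀ (A : ℕ) (t : Fin A → ℕ), ∑ i, (t i + (δ - 1)) = ∑ i, t i + A * (δ - 1) := by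
    intro A t
    rw [Finset.sum_add_distrib, Finset.sum_const, Finset.card_univ, Fintype.card_fin, smul_eq_mul]
  refine ⟨?_, ?_, ?_⟩
  · intro A t ht1 ht hsum hkA
    have hkt : k ≤ ∑ i, t i := by
      rw [hdim] at hsum
      omega
    have hkn : k ≤ n := by omega
    refine ⟨hexB hkn, fun B hB => ?_⟩
    have hns := neverStuck_of_card_lt hr hrk hδ1 hkn hsum.le hq ht B
    refine ⟨hns, hns.exists_isOutcome, exists_isFullBlockCount hk hkt, fun g hg z hz => ?_⟩
    obtain ⟨d, hd, hmin, -⟩ := hasMinDist_blockMatrix hk hkt hB hg hz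
    refine ⟨d, ?_, isLinearLRC_blockMatrix hr hrk hδ ht1 hkt hB hg hsum hmin⟩
    rw [hsum] at hd
    have h : (d : ℤ) + (((k - 1 : ℕ) : ℤ) + z * ((δ - 1 : ℕ) : ℤ)) = n := by exact_mod_cast hd
    rw [Nat.cast_sub hk, Nat.cast_sub hδ1] at h
    push_cast at h
    linarith
  · intro hmod hkA
    have hn : 1 ≤ n := by omega
    have hb := numBlocks_mul_sub_lt hr hδ1 hn hmod
    obtain ⟨hsum, hdef⟩ := sum_stdDims hr hδ1 hn hb
    have ht1 := one_le_stdDims hr hb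
    refine ⟨ht1, hsum, fun B hB g hg => ?_⟩
    have hkt : k ≤ ∑ i, stdDims n r δ i := by
      have := hdim _ (stdDims n r δ)
      omega
    obtain ⟨z, hz, -⟩ := exists_isFullBlockCount hk hkt
    obtain ⟨d, hd, hmin, -⟩ := hasMinDist_blockMatrix hk hkt hB hg hz
    rw [hsum] at hd
    obtain ⟨h1, h2⟩ := dOpt_of_isFullBlockCount hr hk hδ1 (stdDims_le n r δ) hz hd
    refine ⟨d, isLinearLRC_blockMatrix hr hrk hδ ht1 hkt hB hg hsum hmin, fun hdvd => h2 ?_,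
      h1 (by omega)⟩
    obtain ⟨a, ha⟩ := hdvd
    -- `n` and the rounded-up length are multiples of `r + δ - 1` that differ by less than `r`
    have h3 : numBlocks n r δ ≤ a := by
      by_contra hcon
      have h4 := Nat.mul_le_mul_right (r + δ - 1) (not_le.1 hcon)
      rw [Nat.succ_mul, mul_comm a] at h4
      omega
    have h5 := Nat.mul_le_mul_right (r + δ - 1) h3
    rw [mul_comm a] at h5
    omega
  · intro a b hnab hb1 hbδ hkar
    have hsum : ∑ _i : Fin a, (r + (δ - 1)) = a * (r + δ - 1) := by
      rw [Finset.sum_const, Finset.card_univ, Fintype.card_fin, smul_eq_mul, Nat.add_sub_assoc hδ1]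
    have hkt : k ≤ ∑ _i : Fin a, r := by simpa using hkar
    have hkn : k ≤ n := by
      have : a * r ≤ a * (r + δ - 1) := Nat.mul_le_mul_left a (by omega)
      omega
    refine ⟨hexB hkn, fun B hB => ?_⟩
    have hns : NeverStuck (t := fun _ : Fin a => r) k (fun _ => le_rfl) B :=
      neverStuck_of_card_lt hr hrk hδ1 hkn (by rw [hsum]; omega) hq _ B
    refine ⟨hns, hns.exists_isOutcome, fun g hg c => ?_⟩
    obtain ⟨z, hz, -⟩ := exists_isFullBlockCount (t := fun _ : Fin a => r) hk hkt
    obtain ⟨d, hd, hmin, hlow⟩ := hasMinDist_blockMatrix hk hkt hB hg hz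
    have hd1 : 1 ≤ d := by
      obtain ⟨x, -, y, -, hxy, rfl⟩ := hmin.1
      exact hammingDist_pos.2 hxy
    obtain ⟨e, hde, hLRC⟩ := isLinearLRC_appendCopies hr hrk hδ (fun _ => hr) hB hg
      (n := n) (by rw [hsum]; exact hnab.symm) c hd1 hlow
    rw [hsum, show a * (r + δ - 1) = n - b by omega] at hd
    obtain ⟨-, h2⟩ := dOpt_of_isFullBlockCount hr hk hδ1 (fun _ => le_rfl) hz hd
    have h3 := h2 (by simp)
    refine ⟨e, hLRC, by omega, ?_⟩
    have h4 : dOpt (n - b) k r δ = dOpt n k r δ - b := by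
      unfold dOpt
      rw [Nat.cast_sub (by omega)]
      ring
    omega
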